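/- Let $r,s\in\mathbb C^{*}$ be such that $r^{m}s^{n}=1$ with $m,n\in\mathbb Z$ implies $m=n=0$. Let $U=U^{+}_{r,s}(B_2)$ be the $\mathbb C$-algebra generated by $e_1,e_2$ subject to $$e_1^2e_2-(r^2+s^2)e_1e_2e_1+r^2s^2e_2e_1^2=0,$$ $$e_1e_2^3-(r^2+rs+s^2)e_2e_1e_2^2+rs(r^2+rs+s^2)e_2^2e_1e_2-r^3s^3e_2^3e_1=0.$$ Put $X_1=e_1$, $X_2=e_1e_2-r^2e_2e_1$, $X_3=e_2X_2-s^{-2}X_2e_2$, $X_4=e_2$, $W=X_3+(s^{-2}-r^{-1}s^{-1})X_2X_4$ and $Z'=X_1W-s^4WX_1$. Let $Q_4$ be the quantum torus: the $\mathbb C$-algebra generated by $T_1^{\pm1},T_2^{\pm1},T_3^{\pm1},T_4^{\pm1}$ subject to $T_iT_i^{-1}=T_i^{-1}T_i=1$ and $$T_1T_2=s^2T_2T_1,\quad T_1T_3=r^2s^2T_3T_1,\quad T_1T_4=r^2T_4T_1,$$ $$T_2T_3=rsT_3T_2,\quad T_2T_4=s^2T_4T_2,\quad T_3T_4=rsT_4T_3.$$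 **Theorem.** The algebra $U$ has a (right) Goldie quotient ring, that is, a right ring of fractions with respect to its regular elements, and there is an injective algebra homomorphism $\mathcal I:U\to Q_4$ with $\mathcal I(X_i)=T_i$ for $i=1,2,3$ and $$\mathcal I(X_4)=\frac{r}{(r^2-s^2)(r-s)}\left(T_4+(s^4-r^2s^2)T_2^{-1}T_3+(r^{-1}s-1)T_2T_1^{-1}\right).$$ Moreover, let $Q(U)$ be any Goldie quotient ring of $U$. Then $U\to Q(U)$ is injective; the elements $T_1=X_1$, $T_2=X_2$, $T_3=X_3$ and $T_4=X_2^{-1}Z'X_1^{-1}$ of $Q(U)$ are well defined and invertible. Let $B^5=U$ and let $B^4,B^3,B^2,B^1$ be the subalgebras of $Q(U)$ generated respectively by $$\{T_1^{\pm1},X_2,X_3,X_4\},\quad \{T_1^{\pm1},T_2^{\pm1},T_3,T_4\},\quad \{T_1^{\pm1},T_2^{\pm1},T_3^{\pm1},T_4\},\quad \{T_1^{\pm1},T_2^{\pm1},T_3^{\pm1},T_4^{\pm1}\}.$$ Then $T_i\mapsto T_i$ defines an isomorphism $Q_4\cong B^1$, under which $\mathcal I$ becomes the inclusion $U\subset B^1$.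 Put $\Sigma_5=\{T_1^i\mid i\ge 0\}$, $\Sigma_4=\{T_2^i\mid i\ge0\}$, $\Sigma_3=\{T_3^i\mid i\ge0\}$ and $\Sigma_2=\{T_4^i\mid i\ge0\}$. Then $B^5\subset B^4\subset B^3\subset B^2\subset B^1$, $\Sigma_j\subset B^j$ for $j=2,3,4,5$, and (as right rings of fractions) 1. $B^4=B^5\Sigma_5^{-1}$; 2. $B^3=B^4\Sigma_4^{-1}$; 3. $B^2=B^3\Sigma_3^{-1}$; 4. $B^1=B^2\Sigma_2^{-1}$; 5. the center of $B^i$ is the base field $\mathbb C$ for $i=1,2,3,4,5$. -/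

import Mathlib

namespace TwoParamB2

noncomputable section

/-- The two quantum Serre relations of type `B₂`, on the free algebra on `e₁ = ι 0`, `e₂ = ι 1`. -/
inductive SerreRel (r s : ℂ) : FreeAlgebra ℂ (Fin 2) → FreeAlgebra ℂ (Fin 2) → Prop
  | serre₁ (e₁ e₂ : FreeAlgebra ℂ (Fin 2))
      (h₁ : e₁ = FreeAlgebra.ι ℂ 0) (h₂ : e₂ = FreeAlgebra.ι ℂ 1) :
      SerreRel r s
        (e₁ ^ 2 * e₂ - (r ^ 2 + s ^ 2) • (e₁ * e₂ * e₁) + (r ^ 2 * s ^ 2) • (e₂ * e₁ ^ 2)) 0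
  | serre₂ (e₁ e₂ : FreeAlgebra ℂ (Fin 2))
      (h₁ : e₁ = FreeAlgebra.ι ℂ 0) (h₂ : e₂ = FreeAlgebra.ι ℂ 1) :
      SerreRel r s
        (e₁ * e₂ ^ 3 - (r ^ 2 + r * s + s ^ 2) • (e₂ * e₁ * e₂ ^ 2)
          + (r * s * (r ^ 2 + r * s + s ^ 2)) • (e₂ ^ 2 * e₁ * e₂)
          - (r ^ 3 * s ^ 3) • (e₂ ^ 3 * e₁)) 0

/-- The algebra `U = U⁺_{r,s}(B₂)`. -/
abbrev U (r s : ℂ) : Type := RingQuot (SerreRel r s)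

/-- The generator `e₁` of `U`. -/
def e₁ (r s : ℂ) : U r s := RingQuot.mkAlgHom ℂ (SerreRel r s) (FreeAlgebra.ι ℂ 0)

/-- The generator `e₂` of `U`. -/
def e₂ (r s : ℂ) : U r s := RingQuot.mkAlgHom ℂ (SerreRel r s) (FreeAlgebra.ι ℂ 1)

def X₁ (r s : ℂ) : U r s := e₁ r s

/-- `X₂ = e₃ = e₁ e₂ - r² e₂ e₁`. -/
def X₂ (r s : ℂ) : U r s := e₁ r s * e₂ r s - r ^ 2 • (e₂ r s * e₁ r s)

/-- `X₃ = e₂ e₃ - s⁻² e₃ e₂`. -/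
def X₃ (r s : ℂ) : U r s := e₂ r s * X₂ r s - (s⁻¹) ^ 2 • (X₂ r s * e₂ r s)

def X₄ (r s : ℂ) : U r s := e₂ r s

/-- `W = X₃ + (s⁻² - r⁻¹ s⁻¹) X₂ X₄`. -/
def W (r s : ℂ) : U r s := X₃ r s + ((s⁻¹) ^ 2 - r⁻¹ * s⁻¹) • (X₂ r s * X₄ r s)

/-- `Z' = X₁ W - s⁴ W X₁`. -/
def Z' (r s : ℂ) : U r s := X₁ r s * W r s - s ^ 4 • (W r s * X₁ r s)

/-- The defining relations of the quantum torus: `inl i` stands for `Tᵢ₊₁`, `inr i` for its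
inverse. -/
inductive TorusRel (r s : ℂ) :
    FreeAlgebra ℂ (Fin 4 ⊕ Fin 4) → FreeAlgebra ℂ (Fin 4 ⊕ Fin 4) → Prop
  | mul_inv (i : Fin 4) :
      TorusRel r s (FreeAlgebra.ι ℂ (.inl i) * FreeAlgebra.ι ℂ (.inr i)) 1
  | inv_mul (i : Fin 4) :
      TorusRel r s (FreeAlgebra.ι ℂ (.inr i) * FreeAlgebra.ι ℂ (.inl i)) 1
  | comm₁₂ : TorusRel r s (FreeAlgebra.ι ℂ (.inl 0) * FreeAlgebra.ι ℂ (.inl 1))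
      (s ^ 2 • (FreeAlgebra.ι ℂ (.inl 1) * FreeAlgebra.ι ℂ (.inl 0)))
  | comm₁₃ : TorusRel r s (FreeAlgebra.ι ℂ (.inl 0) * FreeAlgebra.ι ℂ (.inl 2))
      ((r ^ 2 * s ^ 2) • (FreeAlgebra.ι ℂ (.inl 2) * FreeAlgebra.ι ℂ (.inl 0)))
  | comm₁₄ : TorusRel r s (FreeAlgebra.ι ℂ (.inl 0) * FreeAlgebra.ι ℂ (.inl 3))
      (r ^ 2 • (FreeAlgebra.ι ℂ (.inl 3) * FreeAlgebra.ι ℂ (.inl 0)))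
  | comm₂₃ : TorusRel r s (FreeAlgebra.ι ℂ (.inl 1) * FreeAlgebra.ι ℂ (.inl 2))
      ((r * s) • (FreeAlgebra.ι ℂ (.inl 2) * FreeAlgebra.ι ℂ (.inl 1)))
  | comm₂₄ : TorusRel r s (FreeAlgebra.ι ℂ (.inl 1) * FreeAlgebra.ι ℂ (.inl 3))
      (s ^ 2 • (FreeAlgebra.ι ℂ (.inl 3) * FreeAlgebra.ι ℂ (.inl 1)))
  | comm₃₄ : TorusRel r s (FreeAlgebra.ι ℂ (.inl 2) * FreeAlgebra.ι ℂ (.inl 3))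
      ((r * s) • (FreeAlgebra.ι ℂ (.inl 3) * FreeAlgebra.ι ℂ (.inl 2)))

/-- The quantum torus `Q₄ = ℂ_{r,s}[T₁^{±1}, T₂^{±1}, T₃^{±1}, T₄^{±1}]`. -/
abbrev Q₄ (r s : ℂ) : Type := RingQuot (TorusRel r s)

/-- The generator `Tᵢ₊₁` of `Q₄`. -/
def torusT (r s : ℂ) (i : Fin 4) : Q₄ r s :=
  RingQuot.mkAlgHom ℂ (TorusRel r s) (FreeAlgebra.ι ℂ (.inl i))

/-- The generator `Tᵢ₊₁⁻¹` of `Q₄`. -/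
def torusTinv (r s : ℂ) (i : Fin 4) : Q₄ r s :=
  RingQuot.mkAlgHom ℂ (TorusRel r s) (FreeAlgebra.ι ℂ (.inr i))

/-- `f : A → B` exhibits `B` as the right ring of fractions `A S⁻¹`: elements of `S` become
invertible, every element of `B` has the form `f a (f σ)⁻¹` with `σ ∈ S`, and the kernel of `f`
is the set of elements killed by right multiplication with some `σ ∈ S`. -/
structure IsRightRingOfFractions {A B : Type*} [Ring A] [Ring B] (S : Submonoid A)
    (f : A →+* B) : Prop where
  isUnit : ∀ σ ∈ S, IsUnit (f σ)
  surj : ∀ b : B, ∃ a : A, ∃ σ ∈ S, b * f σ = f a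
  ker : ∀ a : A, f a = 0 ↔ ∃ σ ∈ S, a * σ = 0

/-- `ι : A → K` is the (classical, Goldie) quotient ring of `A`: the right ring of fractions
with respect to all regular elements. -/
def IsGoldieQuotientRing {A K : Type*} [Ring A] [Ring K] [Algebra ℂ A] [Algebra ℂ K]
    (ι : A →ₐ[ℂ] K) : Prop :=
  IsRightRingOfFractions (nonZeroDivisors A) (ι : A →+* K)

/-- For subalgebras `A`, `B` of `K`: `t ∈ A ⊆ B` and `B = A Σ⁻¹` with `Σ = {tⁱ | i ≥ 0}`. -/
def IsLocalizationAtPowers {K : Type*} [Ring K] [Algebra ℂ K] (A B : Subalgebra ℂ K)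
    (t : K) : Prop :=
  ∃ (hAB : A ≤ B) (ht : t ∈ A),
    IsRightRingOfFractions (Submonoid.powers (⟨t, ht⟩ : A))
      (Subalgebra.inclusion hAB : A →+* B)

/-- The center of `A` is the base field: the structure map from `ℂ` is a bijection onto it. -/
def CenterIsBaseField (A : Type*) [Ring A] [Algebra ℂ A] : Prop :=
  Function.Bijective (algebraMap ℂ (Subalgebra.center ℂ A))

section Chain

variable {r s : ℂ} {K : Type*} [Ring K] [Algebra ℂ K] (ι : U r s →ₐ[ℂ] K) (T : Fin 4 → Kˣ)

/-- The units `T₁, …, T₄` of the quotient ring (indices shifted by one):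
`T₁ = X₁`, `T₂ = X₂`, `T₃ = X₃`, `T₄ = X₂⁻¹ Z' X₁⁻¹`. -/
structure IsTorusVariables : Prop where
  T₁ : (T 0 : K) = ι (X₁ r s)
  T₂ : (T 1 : K) = ι (X₂ r s)
  T₃ : (T 2 : K) = ι (X₃ r s)
  T₄ : (T 3 : K) = ((T 1)⁻¹ : Kˣ) * ι (Z' r s) * ((T 0)⁻¹ : Kˣ)

/-- `B5 = U`, as a subalgebra of the quotient ring. -/
def B5 : Subalgebra ℂ K := ι.range

/-- `B4`, generated by `T₁^{±1}, X₂, X₃, X₄`. -/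
def B4 : Subalgebra ℂ K :=
  Algebra.adjoin ℂ {(T 0 : K), (((T 0)⁻¹ : Kˣ) : K), ι (X₂ r s), ι (X₃ r s), ι (X₄ r s)}

/-- `B3`, generated by `T₁^{±1}, T₂^{±1}, T₃, T₄`. -/
def B3 : Subalgebra ℂ K :=
  Algebra.adjoin ℂ {(T 0 : K), (((T 0)⁻¹ : Kˣ) : K), (T 1 : K), (((T 1)⁻¹ : Kˣ) : K), (T 2 : K), (T 3 : K)}

/-- `B2`, generated by `T₁^{±1}, T₂^{±1}, T₃^{±1}, T₄`. -/
def B2 : Subalgebra ℂ K :=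
  Algebra.adjoin ℂ {(T 0 : K), (((T 0)⁻¹ : Kˣ) : K), (T 1 : K), (((T 1)⁻¹ : Kˣ) : K),
    (T 2 : K), (((T 2)⁻¹ : Kˣ) : K), (T 3 : K)}

/-- `B1`, generated by `T₁^{±1}, T₂^{±1}, T₃^{±1}, T₄^{±1}`. -/
def B1 : Subalgebra ℂ K :=
  Algebra.adjoin ℂ {(T 0 : K), (((T 0)⁻¹ : Kˣ) : K), (T 1 : K), (((T 1)⁻¹ : Kˣ) : K),
    (T 2 : K), (((T 2)⁻¹ : Kˣ) : K), (T 3 : K), (((T 3)⁻¹ : Kˣ) : K)}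

end Chain

end

end TwoParamB2

open TwoParamB2

open TwoParamB2

/-! Everything is compared with the quantum torus `Q₄`, with `T₁, …, T₄` below standing for the
indices `0, …, 3`. Laurent monomials multiply up to nonzero scalars, and conjugation by `T₁` and
`T₂` alone already separates them: multiplicative independence of `r` and `s` turns the two
eigenvalues into four integer equations that determine the exponents
(`Independent.tweight_injective`). Hence the monomials form a basis of `Q₄`, `Q₄` is a domain, every
homomorphism from it to a nonzero algebra is injective, and whatever commutes with `T₁` and `T₂` is
scalar.

The Serre relations are q-commutators, so they can be checked in the torus for the given image of
`e₂`; this gives `toTorus`. In `U` the ordered monomials in `X₄, X₃, X₂, X₁` span, and their images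
have distinct leading terms with respect to the degree in `T₄`. So `U` embeds in `Q₄`
(`embedding_injective`) and is a domain. Since `Q₄` has polynomial growth, two nonzero one-sided
principal ideals of `U` on the same side cannot meet trivially; this gives both Ore conditions and a
Goldie quotient ring.

In any such quotient ring `K` the elements `T₁, …, T₄` satisfy the torus relations, because
identities of `U` can be verified through the embedding. The resulting map `Q₄ → K` is injective
with image `B1`, and it extends `U → K`. Each localization step is tested on generators with
`oreSubalgebra`. All five centers are scalar by one argument, since each algebra contains `X₁ = T₁`
and `X₂ = T₂` and lies in `B1`. -/

namespace TwoParamB2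

/-! ### Units commuting up to a scalar. -/

section QComm

variable {A : Type*} [Ring A] [Algebra ℂ A]

/-- Nonzero scalars as units of an algebra. -/
noncomputable def scalarUnit (A : Type*) [Ring A] [Algebra ℂ A] : ℂˣ →* Aˣ :=
  Units.map (algebraMap ℂ A : ℂ →* A)

lemma scalarUnit_comm (z : ℂˣ) (x : Aˣ) : scalarUnit A z * x = x * scalarUnit A z := by
  ext
  simp [scalarUnit, Algebra.commutes]

lemma scalarUnit_mul_val (z : ℂˣ) (x : Aˣ) :
    ((scalarUnit A z * x : Aˣ) : A) = (z : ℂ) • (x : A) := by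
  simp [scalarUnit, Algebra.smul_def]

/-- The units `x` and `y` commute up to the scalar `z`: `x y = z y x`. -/
def QComm (z : ℂˣ) (x y : Aˣ) : Prop := x * y = scalarUnit A z * (y * x)

lemma QComm.val {z : ℂˣ} {x y : Aˣ} (h : QComm z x y) :
    (x : A) * y = (z : ℂ) • ((y : A) * x) := by
  have := congrArg Units.val h
  rwa [scalarUnit_mul_val] at this

lemma QComm.of_val {z : ℂˣ} {x y : Aˣ} (h : (x : A) * y = (z : ℂ) • ((y : A) * x)) :
    QComm z x y := by
  apply Units.ext
  rw [scalarUnit_mul_val]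
  exact h

lemma qComm_iff_conj {z : ℂˣ} {x y : Aˣ} : QComm z x y ↔ x * y * x⁻¹ = scalarUnit A z * y := by
  rw [QComm, mul_inv_eq_iff_eq_mul, mul_assoc]

lemma QComm.self (x : Aˣ) : QComm 1 x x := by simp [QComm]

lemma QComm.symm {z : ℂˣ} {x y : Aˣ} (h : QComm z x y) : QComm z⁻¹ y x := by
  rw [QComm] at *
  rw [h, map_inv, inv_mul_cancel_left]

/-- The pairs `(z, y)` with `x y = z y x` form a subgroup. -/
noncomputable def qCommSubgroup (x : Aˣ) : Subgroup (ℂˣ × Aˣ) where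
  carrier := {p | QComm p.1 x p.2}
  one_mem' := by simp [QComm]
  mul_mem' {p q} hp hq := by
    simp only [Set.mem_ofPred_eq, qComm_iff_conj] at *
    have : x * (p * q).2 * x⁻¹ = (x * p.2 * x⁻¹) * (x * q.2 * x⁻¹) := by
      simp [mul_assoc]
    rw [this, hp, hq, Prod.fst_mul, Prod.snd_mul, map_mul]
    simp only [mul_assoc]
    rw [← mul_assoc p.2, ← scalarUnit_comm, mul_assoc]
  inv_mem' {p} hp := by
    simp only [Set.mem_ofPred_eq, qComm_iff_conj] at *
    have : x * p⁻¹.2 * x⁻¹ = (x * p.2 * x⁻¹)⁻¹ := by simp [mul_assoc]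
    rw [this, hp, mul_inv_rev, ← map_inv, scalarUnit_comm]
    rfl

lemma QComm.mul {z w : ℂˣ} {x y y' : Aˣ} (h : QComm z x y) (h' : QComm w x y') :
    QComm (z * w) x (y * y') :=
  (qCommSubgroup x).mul_mem (x := (z, y)) (y := (w, y')) h h'

lemma QComm.inv {z : ℂˣ} {x y : Aˣ} (h : QComm z x y) : QComm z⁻¹ x y⁻¹ :=
  (qCommSubgroup x).inv_mem (x := (z, y)) h

lemma QComm.zpow {z : ℂˣ} {x y : Aˣ} (h : QComm z x y) (n : ℤ) : QComm (z ^ n) x (y ^ n) :=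
  (qCommSubgroup x).zpow_mem (x := (z, y)) h n

/-- Commutation up to some nonzero scalar. -/
def QCommutes (x y : Aˣ) : Prop := ∃ z, QComm z x y

lemma QCommutes.symm {x y : Aˣ} : QCommutes x y → QCommutes y x :=
  fun ⟨_, h⟩ ↦ ⟨_, h.symm⟩

lemma QCommutes.mul {x y y' : Aˣ} : QCommutes x y → QCommutes x y' → QCommutes x (y * y') :=
  fun ⟨_, h⟩ ⟨_, h'⟩ ↦ ⟨_, h.mul h'⟩

lemma QCommutes.zpow {x y : Aˣ} (n : ℤ) : QCommutes x y → QCommutes x (y ^ n) :=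
  fun ⟨_, h⟩ ↦ ⟨_, h.zpow n⟩

/-- Equality up to a nonzero scalar. -/
def QEq (x y : Aˣ) : Prop := ∃ z, x = scalarUnit A z * y

lemma QEq.trans {x y w : Aˣ} : QEq x y → QEq y w → QEq x w := by
  rintro ⟨a, rfl⟩ ⟨b, rfl⟩
  exact ⟨a * b, by simp [mul_assoc]⟩

lemma QEq.mul_left {x y : Aˣ} (w : Aˣ) : QEq x y → QEq (w * x) (w * y) := by
  rintro ⟨a, rfl⟩
  exact ⟨a, by rw [← mul_assoc, ← scalarUnit_comm, mul_assoc]⟩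

lemma QEq.mul_right {x y : Aˣ} (w : Aˣ) : QEq x y → QEq (x * w) (y * w) := by
  rintro ⟨a, rfl⟩
  exact ⟨a, mul_assoc _ _ _⟩

lemma QCommutes.qEq_swap {x y : Aˣ} (h : QCommutes x y) (v w : Aˣ) :
    QEq (v * x * (y * w)) (v * y * (x * w)) := by
  obtain ⟨z, h⟩ := h
  have := (QEq.mul_right w (⟨z, h⟩ : QEq (x * y) (y * x))).mul_left v
  simpa only [mul_assoc] using this

end QComm

/-! ### Laurent monomials in q-commuting units. -/

/-- Applying `f k - μ k b` to a linear relation removes the term at `b`, so by induction the other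
coefficients `(μ k i - μ k b) * l i` vanish. If `l i ≠ 0`, then `i` and `b` have the same
eigenvalues for every `k`, which separation forbids. -/
lemma linearIndependent_of_joint_eigenvectors {κ ι V : Type*} [AddCommGroup V] [Module ℂ V]
    (f : κ → Module.End ℂ V) (μ : κ → ι → ℂ) (v : ι → V) (hv : ∀ k i, f k (v i) = μ k i • v i)
    (hne : ∀ i, v i ≠ 0) (hsep : ∀ i j, (∀ k, μ k i = μ k j) → i = j) :
    LinearIndependent ℂ v := by
  classical
  rw [linearIndependent_iff']
  intro t
  induction t using Finset.induction_on with
  | empty => simp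
  | insert b t hb ih =>
    intro l hl
    have key : ∀ i ∈ t, l i = 0 := by
      intro i hi
      by_contra hli
      refine hb ((hsep i b fun k ↦ ?_) ▸ hi)
      have h1 : ∑ j ∈ insert b t, ((μ k j - μ k b) * l j) • v j = 0 := by
        have h2 : f k (∑ j ∈ insert b t, l j • v j) = 0 := by rw [hl, map_zero]
        rw [map_sum] at h2
        have h3 : μ k b • ∑ j ∈ insert b t, l j • v j = 0 := by rw [hl, smul_zero]
        rw [Finset.smul_sum] at h3
        rw [← sub_self (0 : V)]
        nth_rewrite 1 [← h2]
        rw [← h3, ← Finset.sum_sub_distrib]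
        refine Finset.sum_congr rfl fun j _ ↦ ?_
        rw [map_smul, hv]
        module
      rw [Finset.sum_insert hb, sub_self, zero_mul, zero_smul, zero_add] at h1
      have := ih _ h1 i hi
      rcases mul_eq_zero.1 this with h | h
      · exact sub_eq_zero.1 h
      · exact absurd h hli
    intro i hi
    rcases Finset.mem_insert.1 hi with rfl | hi
    · rw [Finset.sum_insert hb, Finset.sum_eq_zero (fun j hj ↦ by rw [key j hj, zero_smul]),
        add_zero] at hl
      exact (smul_eq_zero.1 hl).resolve_right (hne _)
    · exact key i hi

/-- The ordered Laurent monomial `u₀ ^ a₀ u₁ ^ a₁ u₂ ^ a₂ u₃ ^ a₃`. -/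
def tmono {A : Type*} [Ring A] (u : Fin 4 → Aˣ) (a : Fin 4 → ℤ) : Aˣ :=
  u 0 ^ a 0 * u 1 ^ a 1 * u 2 ^ a 2 * u 3 ^ a 3

lemma tmono_zero {A : Type*} [Ring A] {u : Fin 4 → Aˣ} : tmono u 0 = 1 := by simp [tmono]

lemma tmono_single {A : Type*} [Ring A] {u : Fin 4 → Aˣ} (i : Fin 4) (n : ℤ) : tmono u (Pi.single i n) = u i ^ n := by
  fin_cases i <;> simp [tmono]

section Monomials

variable {A : Type*} [Ring A] [Algebra ℂ A]

/-- The defining commutation relations of the quantum torus, for a family of units. -/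
structure IsQTorus (r s : ℂˣ) (u : Fin 4 → Aˣ) : Prop where
  comm₁₂ : QComm (s ^ 2) (u 0) (u 1)
  comm₁₃ : QComm (r ^ 2 * s ^ 2) (u 0) (u 2)
  comm₁₄ : QComm (r ^ 2) (u 0) (u 3)
  comm₂₃ : QComm (r * s) (u 1) (u 2)
  comm₂₄ : QComm (s ^ 2) (u 1) (u 3)
  comm₃₄ : QComm (r * s) (u 2) (u 3)

variable {r s : ℂˣ} {u : Fin 4 → Aˣ}

lemma IsQTorus.qComm₀ (h : IsQTorus r s u) (a : Fin 4 → ℤ) :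
    QComm (r ^ (2 * a 2 + 2 * a 3) * s ^ (2 * a 1 + 2 * a 2)) (u 0) (tmono u a) := by
  have e : r ^ (2 * a 2 + 2 * a 3) * s ^ (2 * a 1 + 2 * a 2) =
      1 ^ a 0 * (s ^ 2) ^ a 1 * (r ^ 2 * s ^ 2) ^ a 2 * (r ^ 2) ^ a 3 := by
    rw [one_zpow, one_mul, mul_zpow, zpow_add, zpow_add, zpow_mul, zpow_mul, zpow_mul, zpow_mul]
    simp only [zpow_ofNat, mul_comm, mul_left_comm, mul_assoc]
  rw [e]
  exact ((((QComm.self (u 0)).zpow (a 0)).mul (h.comm₁₂.zpow (a 1))).mul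
    (h.comm₁₃.zpow (a 2))).mul (h.comm₁₄.zpow (a 3))

lemma IsQTorus.qComm₁ (h : IsQTorus r s u) (a : Fin 4 → ℤ) :
    QComm (r ^ (a 2) * s ^ (-2 * a 0 + a 2 + 2 * a 3)) (u 1) (tmono u a) := by
  have e : r ^ (a 2) * s ^ (-2 * a 0 + a 2 + 2 * a 3) =
      (s ^ 2)⁻¹ ^ a 0 * 1 ^ a 1 * (r * s) ^ a 2 * (s ^ 2) ^ a 3 := by
    rw [one_zpow, mul_one, mul_zpow, zpow_add, zpow_add, zpow_mul, zpow_mul]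
    simp only [zpow_ofNat, zpow_neg, mul_left_comm, mul_assoc]
  rw [e]
  exact (((h.comm₁₂.symm.zpow (a 0)).mul ((QComm.self (u 1)).zpow (a 1))).mul
    (h.comm₂₃.zpow (a 2))).mul (h.comm₂₄.zpow (a 3))

lemma IsQTorus.qCommutes (h : IsQTorus r s u) (i j : Fin 4) : QCommutes (u i) (u j) := by
  fin_cases i <;> fin_cases j <;>
    first
    | exact ⟨_, QComm.self _⟩
    | exact ⟨_, h.comm₁₂⟩ | exact ⟨_, h.comm₁₃⟩ | exact ⟨_, h.comm₁₄⟩ | exact ⟨_, h.comm₂₃⟩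
    | exact ⟨_, h.comm₂₄⟩ | exact ⟨_, h.comm₃₄⟩
    | exact ⟨_, h.comm₁₂.symm⟩ | exact ⟨_, h.comm₁₃.symm⟩ | exact ⟨_, h.comm₁₄.symm⟩
    | exact ⟨_, h.comm₂₃.symm⟩ | exact ⟨_, h.comm₂₄.symm⟩ | exact ⟨_, h.comm₃₄.symm⟩

/-- Sorting the product moves one power at a time to the left, each swap costing a nonzero scalar.
The value of the scalar is never needed, so it is left existential. -/
lemma IsQTorus.tmono_mul (h : IsQTorus r s u) (a b : Fin 4 → ℤ) :
    QEq (tmono u a * tmono u b) (tmono u (a + b)) := by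
  have hc (i j : Fin 4) (m n : ℤ) : QCommutes (u i ^ m) (u j ^ n) :=
    (((h.qCommutes i j).zpow n).symm.zpow m).symm
  have h0 : QCommutes (u 1 ^ a 1 * (u 2 ^ a 2 * u 3 ^ a 3)) (u 0 ^ b 0) :=
    ((hc _ _ _ _).mul ((hc _ _ _ _).mul (hc _ _ _ _))).symm
  have h1 : QCommutes (u 2 ^ a 2 * u 3 ^ a 3) (u 1 ^ b 1) :=
    ((hc _ _ _ _).mul (hc _ _ _ _)).symm
  have h2 : QCommutes (u 3 ^ a 3) (u 2 ^ b 2) := hc _ _ _ _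
  have e0 := h0.qEq_swap (u 0 ^ a 0) (u 1 ^ b 1 * u 2 ^ b 2 * u 3 ^ b 3)
  have e1 := h1.qEq_swap (u 0 ^ a 0 * u 0 ^ b 0 * u 1 ^ a 1) (u 2 ^ b 2 * u 3 ^ b 3)
  have e2 := h2.qEq_swap (u 0 ^ a 0 * u 0 ^ b 0 * u 1 ^ a 1 * u 1 ^ b 1 * u 2 ^ a 2) (u 3 ^ b 3)
  have hl : tmono u a * tmono u b = u 0 ^ a 0 * (u 1 ^ a 1 * (u 2 ^ a 2 * u 3 ^ a 3)) *
      (u 0 ^ b 0 * (u 1 ^ b 1 * u 2 ^ b 2 * u 3 ^ b 3)) := by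
    simp only [tmono, mul_assoc]
  have hr : tmono u (a + b) = u 0 ^ a 0 * u 0 ^ b 0 * u 1 ^ a 1 * u 1 ^ b 1 * u 2 ^ a 2 *
      u 2 ^ b 2 * (u 3 ^ a 3 * u 3 ^ b 3) := by
    simp only [tmono, mul_assoc, Pi.add_apply, zpow_add]
  rw [hl, hr]
  refine e0.trans ?_
  simp only [mul_assoc] at e1 e2 ⊢
  exact e1.trans e2

lemma IsQTorus.tmono_mul_val (h : IsQTorus r s u) (a b : Fin 4 → ℤ) :
    ∃ z : ℂ, z ≠ 0 ∧ (tmono u a : A) * tmono u b = z • (tmono u (a + b) : A) := by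
  obtain ⟨z, hz⟩ := h.tmono_mul a b
  refine ⟨z, z.ne_zero, ?_⟩
  rw [← scalarUnit_mul_val, ← hz, Units.val_mul]

/-- Multiplicative independence of the two parameters. -/
def Independent (r s : ℂˣ) : Prop := ∀ m n : ℤ, r ^ m * s ^ n = 1 → m = 0 ∧ n = 0

lemma Independent.eq {r s : ℂˣ} (h : Independent r s) {m n m' n' : ℤ}
    (e : r ^ m * s ^ n = r ^ m' * s ^ n') : m = m' ∧ n = n' := by
  have := h (m - m') (n - n') (by
    rw [zpow_sub, zpow_sub, mul_mul_mul_comm, e, ← mul_inv, mul_inv_cancel])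
  omega

/-- Conjugation by a unit, as a linear map. -/
def conjEnd (x : Aˣ) : Module.End ℂ A :=
  LinearMap.mulLeft ℂ (x : A) ∘ₗ LinearMap.mulRight ℂ ((x⁻¹ : Aˣ) : A)

lemma QComm.conjEnd_apply {z : ℂˣ} {x y : Aˣ} (h : QComm z x y) :
    conjEnd x (y : A) = (z : ℂ) • (y : A) := by
  rw [← scalarUnit_mul_val, ← qComm_iff_conj.1 h]
  simp [conjEnd, mul_assoc]

/-- The eigenvalues of conjugation by `u 0` and `u 1` on the Laurent monomials. -/
def tweight (r s : ℂˣ) (k : Bool) (a : Fin 4 → ℤ) : ℂˣ :=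
  cond k (r ^ (2 * a 2 + 2 * a 3) * s ^ (2 * a 1 + 2 * a 2))
    (r ^ (a 2) * s ^ (-2 * a 0 + a 2 + 2 * a 3))

/-- The weights determine `a 2`, `a 2 + a 3`, `a 1 + a 2` and `-2 * a 0 + a 2 + 2 * a 3`, hence
successively `a 2`, `a 3`, `a 1`, `a 0`. -/
lemma Independent.tweight_injective (h : Independent r s) {a b : Fin 4 → ℤ}
    (e : ∀ k, tweight r s k a = tweight r s k b) : a = b := by
  have h1 := h.eq (e true)
  have h2 := h.eq (e false)
  ext i
  fin_cases i <;> simp <;> omega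

lemma IsQTorus.conjEnd_tmono (h : IsQTorus r s u) (k : Bool) (a : Fin 4 → ℤ) :
    conjEnd (u (cond k 0 1)) (tmono u a : A) = (tweight r s k a : ℂ) • (tmono u a : A) := by
  cases k
  · exact (h.qComm₁ a).conjEnd_apply
  · exact (h.qComm₀ a).conjEnd_apply

lemma IsQTorus.linearIndependent [Nontrivial A] (h : IsQTorus r s u) (hrs : Independent r s) :
    LinearIndependent ℂ fun a ↦ (tmono u a : A) :=
  linearIndependent_of_joint_eigenvectors (fun k : Bool ↦ conjEnd (u (cond k 0 1)))
    (fun k a ↦ (tweight r s k a : ℂ)) _ h.conjEnd_tmono (fun a ↦ (tmono u a).ne_zero)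
    fun _ _ e ↦ hrs.tweight_injective fun k ↦ Units.ext (e k)

/-- The span of the Laurent monomials with exponents in `S`. -/
def tspan (u : Fin 4 → Aˣ) (S : Set (Fin 4 → ℤ)) : Submodule ℂ A :=
  Submodule.span ℂ ((fun a ↦ (tmono u a : A)) '' S)

lemma tmono_mem_tspan {S : Set (Fin 4 → ℤ)} {a : Fin 4 → ℤ} (ha : a ∈ S) :
    (tmono u a : A) ∈ tspan u S :=
  Submodule.subset_span ⟨a, ha, rfl⟩

lemma tspan_mono {S S' : Set (Fin 4 → ℤ)} (h : S ⊆ S') : tspan u S ≤ tspan u S' :=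
  Submodule.span_mono (Set.image_mono h)

lemma IsQTorus.mul_mem_tspan (h : IsQTorus r s u) {S S' R : Set (Fin 4 → ℤ)}
    (hR : ∀ a ∈ S, ∀ b ∈ S', a + b ∈ R) {x y : A} (hx : x ∈ tspan u S) (hy : y ∈ tspan u S') :
    x * y ∈ tspan u R := by
  have h1 : x * y ∈ tspan u S * tspan u S' := Submodule.mul_mem_mul hx hy
  rw [tspan, tspan, Submodule.span_mul_span] at h1
  refine Submodule.span_le.2 ?_ h1
  rintro _ ⟨_, ⟨a, ha, rfl⟩, _, ⟨b, hb, rfl⟩, rfl⟩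
  obtain ⟨z, -, hz⟩ := h.tmono_mul_val a b
  simp only [hz]
  exact Submodule.smul_mem _ _ (tmono_mem_tspan (hR a ha b hb))

lemma one_mem_tspan {S : Set (Fin 4 → ℤ)} (hS : 0 ∈ S) : (1 : A) ∈ tspan u S := by
  have := tmono_mem_tspan (u := u) hS
  rwa [tmono_zero] at this

/-- The subalgebra spanned by the Laurent monomials. -/
def IsQTorus.subalgebra (h : IsQTorus r s u) : Subalgebra ℂ A :=
  (tspan u Set.univ).toSubalgebra (one_mem_tspan (Set.mem_univ _))
    fun _ _ ↦ h.mul_mem_tspan fun _ _ _ _ ↦ Set.mem_univ _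

end Monomials

lemma injective_of_span_of_linearIndependent {ι V W : Type*} [AddCommGroup V] [Module ℂ V]
    [AddCommGroup W] [Module ℂ W] (f : V →ₗ[ℂ] W) (v : ι → V)
    (hv : Submodule.span ℂ (Set.range v) = ⊤) (hf : LinearIndependent ℂ fun i ↦ f (v i)) :
    Function.Injective f := by
  rw [injective_iff_map_eq_zero]
  intro x hx
  obtain ⟨l, rfl⟩ := Finsupp.mem_span_range_iff_exists_finsupp.1 (hv ▸ Submodule.mem_top : x ∈ _)
  rw [map_finsuppSum] at hx
  have : l = 0 := linearIndependent_iff.1 hf l (by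
    simpa [Finsupp.linearCombination_apply] using hx)
  simp [this]

/-! ### The quantum torus: basis, domain property, center. -/

section Torus

variable {r s : ℂˣ}

/-- The generators of the quantum torus, as units. -/
noncomputable def torusUnit (r s : ℂˣ) (i : Fin 4) : (Q₄ (r : ℂ) s)ˣ where
  val := torusT r s i
  inv := torusTinv r s i
  val_inv := by
    rw [torusT, torusTinv, ← map_mul, RingQuot.mkAlgHom_rel ℂ (TorusRel.mul_inv i), map_one]
  inv_val := by
    rw [torusT, torusTinv, ← map_mul, RingQuot.mkAlgHom_rel ℂ (TorusRel.inv_mul i), map_one]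

lemma torusUnit_isQTorus (r s : ℂˣ) : IsQTorus r s (torusUnit r s) where
  comm₁₂ := .of_val (by
    simpa [torusUnit, torusT] using RingQuot.mkAlgHom_rel ℂ (TorusRel.comm₁₂ (r := r) (s := s)))
  comm₁₃ := .of_val (by
    simpa [torusUnit, torusT] using RingQuot.mkAlgHom_rel ℂ (TorusRel.comm₁₃ (r := r) (s := s)))
  comm₁₄ := .of_val (by
    simpa [torusUnit, torusT] using RingQuot.mkAlgHom_rel ℂ (TorusRel.comm₁₄ (r := r) (s := s)))
  comm₂₃ := .of_val (by
    simpa [torusUnit, torusT] using RingQuot.mkAlgHom_rel ℂ (TorusRel.comm₂₃ (r := r) (s := s)))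
  comm₂₄ := .of_val (by
    simpa [torusUnit, torusT] using RingQuot.mkAlgHom_rel ℂ (TorusRel.comm₂₄ (r := r) (s := s)))
  comm₃₄ := .of_val (by
    simpa [torusUnit, torusT] using RingQuot.mkAlgHom_rel ℂ (TorusRel.comm₃₄ (r := r) (s := s)))

/-- The universal property of the quantum torus. -/
noncomputable def torusLift {A : Type*} [Ring A] [Algebra ℂ A] {u : Fin 4 → Aˣ}
    (h : IsQTorus r s u) : Q₄ (r : ℂ) s →ₐ[ℂ] A :=
  RingQuot.liftAlgHom ℂ ⟨FreeAlgebra.lift ℂ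
    (Sum.elim (fun i ↦ (u i : A)) fun i ↦ (((u i)⁻¹ : Aˣ) : A)), by
    rintro _ _ (i | i | _ | _ | _ | _ | _ | _)
    · simp
    · simp
    · simpa using h.comm₁₂.val
    · simpa using h.comm₁₃.val
    · simpa using h.comm₁₄.val
    · simpa using h.comm₂₃.val
    · simpa using h.comm₂₄.val
    · simpa using h.comm₃₄.val⟩

section Lift

variable {A : Type*} [Ring A] [Algebra ℂ A] {u : Fin 4 → Aˣ} (h : IsQTorus r s u)

@[simp]
lemma torusLift_torusT (i : Fin 4) : torusLift h (torusT r s i) = u i := by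
  simp [torusLift, torusT]

@[simp]
lemma torusLift_torusTinv (i : Fin 4) : torusLift h (torusTinv r s i) = ((u i)⁻¹ : Aˣ) := by
  simp [torusLift, torusTinv]

lemma torusLift_tmono (a : Fin 4 → ℤ) :
    torusLift h (tmono (torusUnit r s) a : Q₄ (r : ℂ) s) = tmono u a := by
  have key (i : Fin 4) :
      Units.map (torusLift h : Q₄ (r : ℂ) s →* A) (torusUnit r s i) = u i :=
    Units.ext (torusLift_torusT h i)
  have : Units.map (torusLift h : Q₄ (r : ℂ) s →* A) (tmono (torusUnit r s) a) = tmono u a := by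
    simp only [tmono, map_mul, map_zpow, key]
  rw [← this]
  rfl

end Lift

lemma ringQuot_adjoin_eq_top {X : Type*} (rel : FreeAlgebra ℂ X → FreeAlgebra ℂ X → Prop) :
    Algebra.adjoin ℂ (Set.range fun x ↦ RingQuot.mkAlgHom ℂ rel (FreeAlgebra.ι ℂ x)) = ⊤ := by
  have := congrArg (Subalgebra.map (RingQuot.mkAlgHom ℂ rel)) (FreeAlgebra.adjoin_range_ι ℂ X)
  rw [AlgHom.map_adjoin, Algebra.map_top, (AlgHom.range_eq_top _).2
    (RingQuot.mkAlgHom_surjective ℂ rel), ← Set.range_comp] at this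
  exact this

lemma torus_adjoin_eq_top (r s : ℂˣ) : Algebra.adjoin ℂ
    (Set.range (torusT (r : ℂ) s) ∪ Set.range (torusTinv (r : ℂ) s)) = ⊤ := by
  rw [← ringQuot_adjoin_eq_top (TorusRel (r : ℂ) s), ← Set.Sum.elim_range]
  congr 2
  ext (i | i) <;> rfl

lemma torus_tspan_eq_top (r s : ℂˣ) : tspan (torusUnit r s) Set.univ = ⊤ := by
  have h : (torusUnit_isQTorus r s).subalgebra = ⊤ := by
    rw [eq_top_iff, ← torus_adjoin_eq_top, Algebra.adjoin_le_iff]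
    rintro _ (⟨i, rfl⟩ | ⟨i, rfl⟩)
    · have := tmono_mem_tspan (u := torusUnit r s) (Set.mem_univ (Pi.single i 1))
      rwa [tmono_single, zpow_one] at this
    · have := tmono_mem_tspan (u := torusUnit r s) (Set.mem_univ (Pi.single i (-1)))
      rwa [tmono_single, zpow_neg_one] at this
  exact (Submodule.eq_top_iff'.2 fun x ↦ (h ▸ Algebra.mem_top : x ∈ IsQTorus.subalgebra _))

lemma torus_span_range_eq_top (r s : ℂˣ) :
    Submodule.span ℂ (Set.range fun a ↦ (tmono (torusUnit r s) a : Q₄ (r : ℂ) s)) = ⊤ := by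
  rw [← torus_tspan_eq_top, tspan, Set.image_univ]

/-- The weighted shift operator `f ↦ (a ↦ w a * f (a + v))`. -/
def weightedShift {G : Type*} [AddGroup G] (w : G → ℂˣ) (v : G) : (Module.End ℂ (G → ℂ))ˣ where
  val := { toFun f a := w a * f (a + v)
           map_add' _ _ := by ext; simp [mul_add]
           map_smul' _ _ := by ext; simp [mul_left_comm] }
  inv := { toFun f a := ((w (a - v))⁻¹ : ℂˣ) * f (a - v)
           map_add' _ _ := by ext; simp [mul_add]
           map_smul' _ _ := by ext; simp [mul_left_comm] }
  val_inv := LinearMap.ext fun f ↦ funext fun a ↦ by simp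
  inv_val := LinearMap.ext fun f ↦ funext fun a ↦ by simp

lemma qComm_weightedShift {G : Type*} [AddCommGroup G] {w w' : G → ℂˣ} {v v' : G} {z : ℂˣ}
    (h : ∀ a, w a * w' (a + v) = z * (w' a * w (a + v'))) :
    QComm z (weightedShift w v) (weightedShift w' v') := by
  refine .of_val (LinearMap.ext fun f ↦ funext fun a ↦ ?_)
  have := congrArg Units.val (h a)
  simp only [Units.val_mul] at this
  simp only [weightedShift, Module.End.mul_apply, LinearMap.coe_mk, AddHom.coe_mk,
    LinearMap.smul_apply, Pi.smul_apply, smul_eq_mul, ← mul_assoc, this]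
  rw [add_right_comm]

/-- A representation of the quantum torus by weighted shifts on `ℤ³`. -/
def torusRep (r s : ℂˣ) : Fin 4 → (Module.End ℂ (ℤ × ℤ × ℤ → ℂ))ˣ :=
  ![weightedShift 1 (1, 0, 0),
    weightedShift (fun a ↦ (s ^ 2) ^ a.1 * (s ^ 2) ^ (-a.2.1) * (r * s) ^ (-a.2.2)) 0,
    weightedShift (fun a ↦ (r ^ 2 * s ^ 2) ^ a.1 * (r * s) ^ (-a.2.1)) (0, 0, 1),
    weightedShift (fun a ↦ (r ^ 2) ^ a.1) (0, 1, 0)]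

lemma torusRep_isQTorus (r s : ℂˣ) : IsQTorus r s (torusRep r s) := by
  -- Each relation reduces to comparing, at a point of the lattice, the two weights picked up along
  -- the two orders of shifting.
  constructor <;> apply qComm_weightedShift <;> rintro ⟨a, b, c⟩ <;>
  · apply Units.ext
    simp [zpow_add, mul_zpow]
    try field_simp

/-- A presentation could collapse to zero; acting on functions on `ℤ³` rules this out. Faithfulness
of the representation is not needed here. -/
instance (r s : ℂˣ) : Nontrivial (Q₄ (r : ℂ) s) :=
  (torusLift (torusRep_isQTorus r s)).toRingHom.domain_nontrivial

/-- The monomial basis of the quantum torus. -/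
noncomputable def torusBasis (hrs : Independent r s) :
    Module.Basis (Fin 4 → ℤ) ℂ (Q₄ (r : ℂ) s) :=
  .mk ((torusUnit_isQTorus r s).linearIndependent hrs) (torus_span_range_eq_top r s).ge

@[simp]
lemma torusBasis_apply (hrs : Independent r s) (a : Fin 4 → ℤ) :
    torusBasis hrs a = tmono (torusUnit r s) a := by
  simp [torusBasis]

/-- The torus relations alone force the image monomials to be independent, so the target only has to
be nonzero. -/
lemma torusLift_injective {A : Type*} [Ring A] [Nontrivial A] [Algebra ℂ A] {u : Fin 4 → Aˣ}
    (h : IsQTorus r s u) (hrs : Independent r s) : Function.Injective (torusLift h) := by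
  refine injective_of_span_of_linearIndependent (torusLift h).toLinearMap _
    (torus_span_range_eq_top r s) ?_
  simp only [AlgHom.toLinearMap_apply, torusLift_tmono]
  exact h.linearIndependent hrs

lemma mem_torus_tspan_iff (hrs : Independent r s) {S : Set (Fin 4 → ℤ)} {x : Q₄ (r : ℂ) s} :
    x ∈ tspan (torusUnit r s) S ↔ ∀ a, (torusBasis hrs).repr x a ≠ 0 → a ∈ S := by
  have := (torusBasis hrs).mem_span_image (m := x) (s := S)
  simp only [torusBasis_apply] at this
  rw [tspan, this]
  simp [Set.subset_def]

/-- Two nonempty finite supports have a sum `g + h` attained only once; there the coefficient of the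
product is a single product of nonzero scalars. -/
lemma noZeroDivisors_of_basis {G A : Type*} [Add G] [UniqueSums G] [Ring A] [Algebra ℂ A]
    (b : Module.Basis G ℂ A)
    (hb : ∀ g h, ∃ z : ℂ, z ≠ 0 ∧ b g * b h = z • b (g + h)) : NoZeroDivisors A := by
  classical
  choose c hc hcb using hb
  refine ⟨fun {x y} hxy ↦ ?_⟩
  by_contra! hne
  have hx : (b.repr x).support.Nonempty := by simpa [Finsupp.support_nonempty_iff] using hne.1
  have hy : (b.repr y).support.Nonempty := by simpa [Finsupp.support_nonempty_iff] using hne.2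
  obtain ⟨g, hg, h, hh, hu⟩ := UniqueSums.uniqueAdd_of_nonempty hx hy
  have key : b.repr (x * y) (g + h) = b.repr x g * b.repr y h * c g h := by
    conv_lhs => rw [← b.linearCombination_repr x, ← b.linearCombination_repr y]
    simp only [Finsupp.linearCombination_apply, Finsupp.sum, Finset.sum_mul_sum, map_sum,
      Finsupp.coe_finsetSum, Finset.sum_apply, smul_mul_smul_comm, hcb, map_smul,
      Module.Basis.repr_self, Finsupp.smul_apply, smul_eq_mul]
    rw [Finset.sum_eq_single_of_mem g hg, Finset.sum_eq_single_of_mem h hh]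
    · simp
    · intro k hk hkh
      rw [Finsupp.single_eq_of_ne fun e ↦ hkh (hu hg hk e.symm).2]
      simp
    · intro k hk hkg
      refine Finset.sum_eq_zero fun l hl ↦ ?_
      rw [Finsupp.single_eq_of_ne fun e ↦ hkg (hu hk hl e.symm).1]
      simp
  rw [hxy, map_zero, Finsupp.zero_apply] at key
  exact mul_ne_zero (mul_ne_zero (Finsupp.mem_support_iff.1 hg) (Finsupp.mem_support_iff.1 hh))
    (hc g h) key.symm

lemma torus_noZeroDivisors (hrs : Independent r s) : NoZeroDivisors (Q₄ (r : ℂ) s) :=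
  noZeroDivisors_of_basis (torusBasis hrs) fun g h ↦ by
    simpa using (torusUnit_isQTorus r s).tmono_mul_val g h

/-- An element fixed by both conjugations is supported on monomials of weight one, and only the zero
exponent has the same weights as `1`. -/
lemma torus_eq_algebraMap_of_commute (hrs : Independent r s) {x : Q₄ (r : ℂ) s}
    (h₀ : Commute (torusT (r : ℂ) s 0) x) (h₁ : Commute (torusT (r : ℂ) s 1) x) :
    ∃ c : ℂ, algebraMap ℂ _ c = x := by
  set b := torusBasis hrs
  have hconj (k : Bool) : conjEnd (torusUnit r s (cond k 0 1)) x = x := by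
    have hk : Commute (torusUnit r s (cond k 0 1) : Q₄ (r : ℂ) s) x := by
      cases k
      · exact h₁
      · exact h₀
    simp only [conjEnd, LinearMap.comp_apply, LinearMap.mulRight_apply, LinearMap.mulLeft_apply]
    rw [← mul_assoc, hk.eq, mul_assoc, Units.mul_inv, mul_one]
  have hrepr (k : Bool) (y : Q₄ (r : ℂ) s) (a : Fin 4 → ℤ) :
      b.repr (conjEnd (torusUnit r s (cond k 0 1)) y) a = (tweight r s k a : ℂ) * b.repr y a := by
    have : b.coord a ∘ₗ conjEnd (torusUnit r s (cond k 0 1)) =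
        (tweight r s k a : ℂ) • b.coord a := b.ext fun g ↦ by
      simp only [b, torusBasis_apply, LinearMap.comp_apply, LinearMap.smul_apply,
        (torusUnit_isQTorus r s).conjEnd_tmono, map_smul]
      rw [← torusBasis_apply hrs, Module.Basis.coord_apply, Module.Basis.repr_self]
      rcases eq_or_ne a g with rfl | h
      · rfl
      · simp [h]
    exact LinearMap.congr_fun this y
  have hsupp (a : Fin 4 → ℤ) (ha : a ≠ 0) : b.repr x a = 0 := by
    by_contra hxa
    refine ha (hrs.tweight_injective fun k ↦ Units.ext ?_)
    have := hrepr k x a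
    rw [hconj, eq_comm, mul_eq_right₀ hxa] at this
    rw [this]
    cases k <;> simp [tweight]
  refine ⟨b.repr x 0, b.repr.injective (Finsupp.ext fun a ↦ ?_)⟩
  have : (1 : Q₄ (r : ℂ) s) = b 0 := by simp [b, tmono_zero]
  rw [Algebra.algebraMap_eq_smul_one, this, map_smul, b.repr_self, Finsupp.smul_apply]
  rcases eq_or_ne a 0 with rfl | ha
  · simp
  · simp [hsupp a ha, ha]

end Torus

/-! ### The Serre relations as q-commutators. -/

section Serre

variable {A : Type*} [Ring A] [Algebra ℂ A] (r s : ℂ) (x y : A)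

/-- The `q`-commutator `x y - r² y x`. -/
def rootTwo : A := x * y - r ^ 2 • (y * x)

/-- The iterated `q`-commutator of `y` with `x y - r² y x`. -/
noncomputable def rootThree : A := y * rootTwo r x y - (s⁻¹) ^ 2 • (rootTwo r x y * y)

lemma serre₁_eq :
    x ^ 2 * y - (r ^ 2 + s ^ 2) • (x * y * x) + (r ^ 2 * s ^ 2) • (y * x ^ 2) =
      x * rootTwo r x y - s ^ 2 • (rootTwo r x y * x) := by
  simp only [rootTwo, mul_sub, sub_mul, mul_smul_comm, smul_mul_assoc, pow_two, mul_assoc]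
  module

lemma serre₂_eq (hs : s ≠ 0) :
    x * y ^ 3 - (r ^ 2 + r * s + s ^ 2) • (y * x * y ^ 2)
          + (r * s * (r ^ 2 + r * s + s ^ 2)) • (y ^ 2 * x * y)
          - (r ^ 3 * s ^ 3) • (y ^ 3 * x) =
      -s ^ 2 • (rootThree r s x y * y - (r * s) • (y * rootThree r s x y)) := by
  simp only [rootThree, rootTwo, mul_sub, sub_mul, mul_smul_comm, smul_mul_assoc, pow_succ,
    pow_zero, one_mul, mul_assoc, smul_sub]
  match_scalars <;> field_simp <;> ring

end Serre

/-! ### Commutation relations among the root vectors. -/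

section Relations

variable {r s : ℂˣ}

local notation "x₁" => X₁ (r : ℂ) (s : ℂ)
local notation "x₂" => X₂ (r : ℂ) (s : ℂ)
local notation "x₃" => X₃ (r : ℂ) (s : ℂ)
local notation "x₄" => X₄ (r : ℂ) (s : ℂ)

lemma X₁_mul_X₄ : x₁ * x₄ = ((r : ℂ) ^ 2) • (x₄ * x₁) + x₂ := by
  simp [X₁, X₂, X₄]

lemma X₂_mul_X₄ : x₂ * x₄ = ((s : ℂ) ^ 2) • (x₄ * x₂) - ((s : ℂ) ^ 2) • x₃ := by
  have : (s : ℂ) ≠ 0 := s.ne_zero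
  rw [X₃, ← X₄]
  match_scalars <;> field_simp <;> ring

lemma X₁_mul_X₂ : x₁ * x₂ = ((s : ℂ) ^ 2) • (x₂ * x₁) := by
  have := RingQuot.mkAlgHom_rel ℂ (SerreRel.serre₁ (r := (r : ℂ)) (s := (s : ℂ)) _ _ rfl rfl)
  rw [serre₁_eq, map_zero] at this
  rw [← sub_eq_zero]
  simpa [rootTwo, X₁, X₂, e₁, e₂] using this

lemma X₃_mul_X₄ : x₃ * x₄ = (r * s : ℂ) • (x₄ * x₃) := by
  have := RingQuot.mkAlgHom_rel ℂ (SerreRel.serre₂ (r := (r : ℂ)) (s := (s : ℂ)) _ _ rfl rfl)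
  rw [serre₂_eq _ _ _ _ s.ne_zero, map_zero, map_smul,
    smul_eq_zero_iff_right (neg_ne_zero.2 (pow_ne_zero _ s.ne_zero))] at this
  rw [← sub_eq_zero]
  simpa [rootTwo, rootThree, X₃, X₂, X₄, e₁, e₂] using this

lemma X₃_eq : x₃ = x₄ * x₂ - ((s : ℂ)⁻¹) ^ 2 • (x₂ * x₄) := rfl

lemma X₁_mul_X₃ : x₁ * x₃ = (r ^ 2 * s ^ 2 : ℂ) • (x₃ * x₁) := by
  have : (s : ℂ) ≠ 0 := s.ne_zero
  have a12 (z : U (r : ℂ) s) : x₁ * (x₂ * z) = ((s : ℂ) ^ 2) • (x₂ * (x₁ * z)) := by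
    rw [← mul_assoc, X₁_mul_X₂, smul_mul_assoc, mul_assoc]
  have a14 (z : U (r : ℂ) s) : x₁ * (x₄ * z) = ((r : ℂ) ^ 2) • (x₄ * (x₁ * z)) + x₂ * z := by
    rw [← mul_assoc, X₁_mul_X₄, add_mul, smul_mul_assoc, mul_assoc]
  rw [X₃_eq]
  simp only [mul_sub, sub_mul, mul_smul_comm, smul_mul_assoc, mul_assoc, a12, a14, X₁_mul_X₂,
    X₁_mul_X₄, smul_sub, mul_add, smul_add]
  match_scalars <;> field_simp <;> ring

/-- Multiplying the relation between `X₃` and `X₄` by `X₁` on the left and moving `X₁` to the right,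
the `X₄ X₃ X₁` terms cancel. What remains comes from the summand `X₂` of `X₁_mul_X₄`, up to the
common factor `r s`. -/
lemma X₂_mul_X₃ : x₂ * x₃ = (r * s : ℂ) • (x₃ * x₂) := by
  have hr : (r : ℂ) ≠ 0 := r.ne_zero
  have hs : (s : ℂ) ≠ 0 := s.ne_zero
  have a13 (z : U (r : ℂ) s) : x₁ * (x₃ * z) = (r ^ 2 * s ^ 2 : ℂ) • (x₃ * (x₁ * z)) := by
    rw [← mul_assoc, X₁_mul_X₃, smul_mul_assoc, mul_assoc]
  have a34 (z : U (r : ℂ) s) : x₃ * (x₄ * z) = (r * s : ℂ) • (x₄ * (x₃ * z)) := by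
    rw [← mul_assoc, X₃_mul_X₄, smul_mul_assoc, mul_assoc]
  have a14 (z : U (r : ℂ) s) : x₁ * (x₄ * z) = ((r : ℂ) ^ 2) • (x₄ * (x₁ * z)) + x₂ * z := by
    rw [← mul_assoc, X₁_mul_X₄, add_mul, smul_mul_assoc, mul_assoc]
  have h := congrArg (x₁ * ·) (X₃_mul_X₄ (r := r) (s := s))
  simp only [mul_smul_comm, a13, a14, X₁_mul_X₄, X₁_mul_X₃, mul_add, smul_add, a34] at h
  have h2 : (r * s : ℂ) • (x₂ * x₃) = (r * s : ℂ) • ((r * s : ℂ) • (x₃ * x₂)) := by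
    linear_combination (norm := module) - h
  exact smul_right_injective _ (mul_ne_zero hr hs) h2

end Relations

/-! ### PBW monomials span. -/

section Spanning

variable (r s : ℂˣ)

/-- The ordered monomials `X₃ ^ c X₂ ^ b X₁ ^ a`. -/
noncomputable def lowMonomial (a b c : ℕ) : U (r : ℂ) s :=
  X₃ (r : ℂ) s ^ c * (X₂ (r : ℂ) s ^ b * X₁ (r : ℂ) s ^ a)

/-- The PBW monomials `X₄ ^ d X₃ ^ c X₂ ^ b X₁ ^ a`. -/
noncomputable def pbwMonomial (n : ℕ × ℕ × ℕ × ℕ) : U (r : ℂ) s :=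
  X₄ (r : ℂ) s ^ n.2.2.2 * lowMonomial r s n.1 n.2.1 n.2.2.1

lemma mul_pow_of_qcomm {A : Type*} [Ring A] [Algebra ℂ A] {x y : A} {z : ℂ}
    (h : x * y = z • (y * x)) (n : ℕ) : x * y ^ n = z ^ n • (y ^ n * x) := by
  induction n with
  | zero => simp
  | succ n ih =>
    rw [pow_succ, ← mul_assoc, ih, smul_mul_assoc, mul_assoc, h, mul_smul_comm, smul_smul,
      mul_assoc, pow_succ]

/-- The span of the PBW monomials. -/
noncomputable def pbwSpan : Submodule ℂ (U (r : ℂ) s) :=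
  Submodule.span ℂ (Set.range (pbwMonomial r s))

variable {r s}

lemma pow_mul_lowMonomial_mem (a b c d : ℕ) :
    X₄ (r : ℂ) s ^ d * lowMonomial r s a b c ∈ pbwSpan r s :=
  Submodule.subset_span ⟨(a, b, c, d), rfl⟩

lemma X₄_mul_mem_pbwSpan {u : U (r : ℂ) s} (hu : u ∈ pbwSpan r s) :
    X₄ (r : ℂ) s * u ∈ pbwSpan r s := by
  induction hu using Submodule.span_induction with
  | mem _ h =>
    obtain ⟨⟨a, b, c, d⟩, rfl⟩ := h
    rw [pbwMonomial, ← mul_assoc, ← pow_succ']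
    exact pow_mul_lowMonomial_mem _ _ _ _
  | zero => simp
  | add _ _ _ _ h h' => rw [mul_add]; exact add_mem h h'
  | smul c _ _ h => rw [mul_smul_comm]; exact Submodule.smul_mem _ _ h

lemma X₃_mul_lowMonomial (a b c : ℕ) :
    X₃ (r : ℂ) s * lowMonomial r s a b c = lowMonomial r s a b (c + 1) := by
  rw [lowMonomial, lowMonomial, ← mul_assoc, ← pow_succ']

lemma X₂_mul_lowMonomial (a b c : ℕ) :
    X₂ (r : ℂ) s * lowMonomial r s a b c = (r * s : ℂ) ^ c • lowMonomial r s a (b + 1) c := by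
  rw [lowMonomial, lowMonomial, ← mul_assoc, mul_pow_of_qcomm X₂_mul_X₃, smul_mul_assoc,
    mul_assoc, ← mul_assoc (X₂ _ _), ← pow_succ']

lemma X₁_mul_lowMonomial (a b c : ℕ) :
    X₁ (r : ℂ) s * lowMonomial r s a b c =
      ((r ^ 2 * s ^ 2 : ℂ) ^ c * ((s : ℂ) ^ 2) ^ b) • lowMonomial r s (a + 1) b c := by
  rw [lowMonomial, lowMonomial, ← mul_assoc, mul_pow_of_qcomm X₁_mul_X₃, smul_mul_assoc,
    mul_assoc, ← mul_assoc (X₁ _ _), mul_pow_of_qcomm X₁_mul_X₂, smul_mul_assoc, mul_smul_comm,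
    smul_smul, mul_assoc, ← pow_succ']

/-- The three claims need one simultaneous induction on `d`: moving `X₁` past `X₄` produces `X₂`,
moving `X₂` past `X₄` produces `X₃`, and `X₃` merely q-commutes with `X₄`. -/
lemma mul_pow_mul_lowMonomial_mem (d : ℕ) : ∀ a b c : ℕ,
    X₁ (r : ℂ) s * (X₄ (r : ℂ) s ^ d * lowMonomial r s a b c) ∈ pbwSpan r s ∧
    X₂ (r : ℂ) s * (X₄ (r : ℂ) s ^ d * lowMonomial r s a b c) ∈ pbwSpan r s ∧
    X₃ (r : ℂ) s * (X₄ (r : ℂ) s ^ d * lowMonomial r s a b c) ∈ pbwSpan r s := by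
  induction d with
  | zero =>
    intro a b c
    simp only [pow_zero, one_mul, X₁_mul_lowMonomial, X₂_mul_lowMonomial, X₃_mul_lowMonomial]
    have h (a b c : ℕ) : lowMonomial r s a b c ∈ pbwSpan r s := by
      simpa using pow_mul_lowMonomial_mem (r := r) (s := s) a b c 0
    exact ⟨Submodule.smul_mem _ _ (h _ _ _), Submodule.smul_mem _ _ (h _ _ _), h _ _ _⟩
  | succ d ih =>
    intro a b c
    obtain ⟨h1, h2, h3⟩ := ih a b c
    have e (z : U (r : ℂ) s) : z * (X₄ (r : ℂ) s ^ (d + 1) * lowMonomial r s a b c) =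
        (z * X₄ (r : ℂ) s) * (X₄ (r : ℂ) s ^ d * lowMonomial r s a b c) := by
      rw [pow_succ', mul_assoc, mul_assoc]
    simp only [e, X₁_mul_X₄, X₂_mul_X₄, X₃_mul_X₄, add_mul, sub_mul, smul_mul_assoc]
    simp only [mul_assoc (X₄ _ _)]
    exact ⟨add_mem (Submodule.smul_mem _ _ (X₄_mul_mem_pbwSpan h1)) h2,
      sub_mem (Submodule.smul_mem _ _ (X₄_mul_mem_pbwSpan h2)) (Submodule.smul_mem _ _ h3),
      Submodule.smul_mem _ _ (X₄_mul_mem_pbwSpan h3)⟩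

lemma X₁_mul_mem_pbwSpan {u : U (r : ℂ) s} (hu : u ∈ pbwSpan r s) :
    X₁ (r : ℂ) s * u ∈ pbwSpan r s := by
  induction hu using Submodule.span_induction with
  | mem _ h =>
    obtain ⟨⟨a, b, c, d⟩, rfl⟩ := h
    exact (mul_pow_mul_lowMonomial_mem d a b c).1
  | zero => simp
  | add _ _ _ _ h h' => rw [mul_add]; exact add_mem h h'
  | smul c _ _ h => rw [mul_smul_comm]; exact Submodule.smul_mem _ _ h

lemma adjoin_X₁_X₄ : Algebra.adjoin ℂ {X₁ (r : ℂ) s, X₄ (r : ℂ) s} = ⊤ := by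
  rw [← ringQuot_adjoin_eq_top (SerreRel (r : ℂ) s)]
  congr 1
  ext x
  simp [Fin.exists_fin_two, X₁, X₄, e₁, e₂, eq_comm]

lemma pbwSpan_eq_top : pbwSpan r s = ⊤ := by
  have key (u : U (r : ℂ) s) : ∀ v ∈ pbwSpan r s, u * v ∈ pbwSpan r s := by
    have hu : u ∈ Algebra.adjoin ℂ {X₁ (r : ℂ) s, X₄ (r : ℂ) s} := by
      rw [adjoin_X₁_X₄]; trivial
    induction hu using Algebra.adjoin_induction with
    | mem x hx =>
      rcases hx with rfl | rfl
      · exact fun _ ↦ X₁_mul_mem_pbwSpan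
      · exact fun _ ↦ X₄_mul_mem_pbwSpan
    | algebraMap c =>
      intro v hv
      rw [← Algebra.smul_def]
      exact Submodule.smul_mem _ _ hv
    | add x y _ _ hx hy =>
      intro v hv
      rw [add_mul]
      exact add_mem (hx v hv) (hy v hv)
    | mul x y _ _ hx hy =>
      intro v hv
      rw [mul_assoc]
      exact hx _ (hy v hv)
  have one : (1 : U (r : ℂ) s) ∈ pbwSpan r s := by
    simpa [lowMonomial] using pow_mul_lowMonomial_mem (r := r) (s := s) 0 0 0 0
  exact Submodule.eq_top_iff'.2 fun u ↦ by simpa using key u 1 one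

end Spanning

/-! ### The homomorphism to the torus. -/

section Embedding

variable {A : Type*} [Ring A] [Algebra ℂ A] {r s : ℂˣ} {u : Fin 4 → Aˣ}

/-- The image of `e₂` in an algebra with a family of units satisfying the torus relations. -/
noncomputable def torusE₂ (r s : ℂ) (u : Fin 4 → Aˣ) : A :=
  (r / ((r ^ 2 - s ^ 2) * (r - s))) •
    ((u 3 : A) + (s ^ 4 - r ^ 2 * s ^ 2) • (((u 1)⁻¹ : Aˣ) * (u 2 : A))
      + (r⁻¹ * s - 1) • ((u 1 : A) * ((u 0)⁻¹ : Aˣ)))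

lemma Independent.sq_sub_sq_ne_zero (hrs : Independent r s) : (r ^ 2 - s ^ 2 : ℂ) ≠ 0 := by
  intro h
  have h1 : r ^ 2 = s ^ 2 := Units.ext (by simpa using sub_eq_zero.1 h)
  have := hrs 2 (-2) (by rw [zpow_neg, zpow_ofNat, zpow_ofNat, h1, mul_inv_cancel])
  omega

lemma Independent.sub_ne_zero (hrs : Independent r s) : (r - s : ℂ) ≠ 0 := by
  intro h
  have h1 : r = s := Units.ext (_root_.sub_eq_zero.1 h)
  have := hrs 1 (-1) (by rw [zpow_neg, zpow_one, zpow_one, h1, mul_inv_cancel])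
  omega

/-- The summands `T₄` and `T₂⁻¹ T₃` are killed, since `T₁` moves past both with factor `r²`; the
coefficient of `T₂ T₁⁻¹` is normalized to leave exactly `T₂`. -/
lemma IsQTorus.rootTwo_eq (h : IsQTorus r s u) (hrs : Independent r s) :
    rootTwo (r : ℂ) (u 0 : A) (torusE₂ r s u) = u 1 := by
  have hr := r.ne_zero
  have h1 := hrs.sq_sub_sq_ne_zero
  have h2 := hrs.sub_ne_zero
  have a1 := h.comm₁₄.val
  have a2 := (h.comm₁₂.inv.mul h.comm₁₃).val
  have a3 : (u 0 : A) * ((u 1 : A) * ((u 0)⁻¹ : Aˣ)) = ((s : ℂ) ^ 2) • (u 1 : A) := by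
    rw [← mul_assoc, h.comm₁₂.val, smul_mul_assoc, Units.mul_inv_cancel_right]
    simp
  simp only [rootTwo, torusE₂, mul_add, add_mul, mul_smul_comm, smul_mul_assoc, smul_add]
  simp only [Units.val_mul, Units.val_pow_eq_pow_val, Units.val_inv_eq_inv_val] at a1 a2
  rw [a1, a2, a3, Units.inv_mul_cancel_right]
  match_scalars <;> field_simp <;> ring

/-- Now the `T₄` and `T₂ T₁⁻¹` summands cancel, and the coefficient of `T₂⁻¹ T₃` is the one that
leaves `T₃`. -/
lemma IsQTorus.rootThree_eq (h : IsQTorus r s u) (hrs : Independent r s) :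
    rootThree (r : ℂ) s (u 0 : A) (torusE₂ r s u) = u 2 := by
  have hr := r.ne_zero
  have hs := s.ne_zero
  have h1 := hrs.sq_sub_sq_ne_zero
  have h2 := hrs.sub_ne_zero
  have a1 := h.comm₂₄.val
  have a2 : ((u 1)⁻¹ : Aˣ) * (u 2 : A) * (u 1 : A) = ((r * s : ℂ)⁻¹) • (u 2 : A) := by
    have := h.comm₂₃.symm.val
    rw [mul_assoc, this, mul_smul_comm, Units.inv_mul_cancel_left]
    simp
  have a3 := ((QComm.self (u 1)).mul h.comm₁₂.symm.inv).val
  rw [rootThree, h.rootTwo_eq hrs]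
  simp only [torusE₂, mul_add, add_mul, mul_smul_comm, smul_mul_assoc, smul_add]
  simp only [Units.val_mul, Units.val_pow_eq_pow_val, inv_inv] at a1 a3
  rw [a1, a2, a3, Units.mul_inv_cancel_left]
  match_scalars <;> field_simp <;> ring

lemma IsQTorus.mul_torusE₂ (h : IsQTorus r s u) :
    (u 2 : A) * torusE₂ r s u = (r * s : ℂ) • (torusE₂ r s u * u 2) := by
  have hr := r.ne_zero
  have hs := s.ne_zero
  have a1 := h.comm₃₄.val
  have a2 := (h.comm₂₃.symm.inv.mul (QComm.self (u 2))).val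
  have a3 := (h.comm₂₃.symm.mul h.comm₁₃.symm.inv).val
  simp only [torusE₂, mul_add, add_mul, mul_smul_comm, smul_mul_assoc, smul_add]
  simp only [Units.val_mul, Units.val_pow_eq_pow_val, Units.val_inv_eq_inv_val, inv_inv] at a1 a2 a3
  rw [a1, a2, a3]
  match_scalars <;> field_simp

/-- The homomorphism from `U` to an algebra with a family of units satisfying the torus
relations. -/
noncomputable def toTorus (h : IsQTorus r s u) (hrs : Independent r s) :
    U (r : ℂ) s →ₐ[ℂ] A :=
  RingQuot.liftAlgHom ℂ ⟨FreeAlgebra.lift ℂ ![(u 0 : A), torusE₂ r s u], by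
    rintro _ _ (⟨_, _, rfl, rfl⟩ | ⟨_, _, rfl, rfl⟩)
    · rw [serre₁_eq, map_zero]
      have h2 := h.rootTwo_eq hrs
      simp only [rootTwo] at h2
      simp [rootTwo, h2, h.comm₁₂.val]
    · rw [serre₂_eq _ _ _ _ s.ne_zero, map_zero]
      have h3 := h.rootThree_eq hrs
      simp only [rootThree, rootTwo] at h3
      simp only [rootThree, rootTwo, map_smul, map_sub, map_mul, FreeAlgebra.lift_ι_apply,
        Matrix.cons_val_zero, Matrix.cons_val_one, h3, h.mul_torusE₂]
      simp⟩

variable (h : IsQTorus r s u) (hrs : Independent r s)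

lemma toTorus_X₁ : toTorus h hrs (X₁ r s) = u 0 := by simp [toTorus, X₁, e₁]

lemma toTorus_X₄ : toTorus h hrs (X₄ r s) = torusE₂ r s u := by simp [toTorus, X₄, e₂]

lemma toTorus_X₂ : toTorus h hrs (X₂ r s) = u 1 := by
  rw [← h.rootTwo_eq hrs, rootTwo, ← toTorus_X₁ h hrs, ← toTorus_X₄ h hrs]
  simp [X₁, X₂, X₄]

lemma toTorus_X₃ : toTorus h hrs (X₃ r s) = u 2 := by
  rw [← h.rootThree_eq hrs, rootThree, h.rootTwo_eq hrs, ← toTorus_X₄ h hrs,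
    ← toTorus_X₂ h hrs]
  simp [X₃, X₄]

/-- In the image of `W` the `T₃` terms cancel, and the twist by `s⁴` kills the `T₂² T₁⁻¹` term. Only
`T₂ T₄` survives, which is why `T₄` is recovered as `X₂⁻¹ Z' X₁⁻¹`. -/
lemma toTorus_Z' : toTorus h hrs (Z' r s) = (u 1 : A) * u 3 * u 0 := by
  have hr := r.ne_zero
  have hs := s.ne_zero
  have h1 := hrs.sq_sub_sq_ne_zero
  have h2 := hrs.sub_ne_zero
  have a1 := (h.comm₁₂.mul h.comm₁₄).val
  have a2 := h.comm₁₃.val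
  have a3 := ((h.comm₁₂.mul h.comm₁₂).mul (QComm.self (u 0)).inv).val
  simp only [Units.val_mul, Units.val_pow_eq_pow_val, inv_one, mul_one,
    Units.inv_mul_cancel_right] at a1 a2 a3
  have e : toTorus h hrs (W r s) = (u 2 : A) + (((s : ℂ)⁻¹) ^ 2 - (r : ℂ)⁻¹ * (s : ℂ)⁻¹) •
      ((u 1 : A) * torusE₂ r s u) := by
    simp [W, toTorus_X₂, toTorus_X₃, toTorus_X₄]
  have e' : toTorus h hrs (Z' r s) = (u 0 : A) * toTorus h hrs (W r s) -
      ((s : ℂ) ^ 4) • (toTorus h hrs (W r s) * u 0) := by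
    simp [Z', toTorus_X₁]
  rw [e', e]
  simp only [torusE₂, mul_add, add_mul, mul_smul_comm, smul_mul_assoc, smul_add,
    Units.mul_inv_cancel_left]
  rw [← mul_assoc (u 1 : A) (u 1 : A), a1, a2, a3, Units.inv_mul_cancel_right]
  match_scalars <;> field_simp <;> ring

end Embedding

/-! ### Injectivity by leading terms. -/

/-- In a relation, take an index whose leading exponent has maximal degree. Another vector could
reach that exponent only from a strictly larger degree, so ties in degree do no harm. -/
lemma linearIndependent_of_leading {G ι V : Type*} [AddCommGroup V] [Module ℂ V]
    (b : Module.Basis G ℂ V) (deg : G → ℤ) (v : ι → V) (f : ι → G)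
    (hf : Function.Injective f) (hlead : ∀ i, b.repr (v i) (f i) ≠ 0)
    (hlow : ∀ i g, g ≠ f i → b.repr (v i) g ≠ 0 → deg g < deg (f i)) :
    LinearIndependent ℂ v := by
  rw [linearIndependent_iff]
  intro l hl
  by_contra hne
  obtain ⟨i, hi, hmax⟩ := l.support.exists_max_image (fun i ↦ deg (f i))
    (Finsupp.support_nonempty_iff.2 hne)
  have h : b.repr (Finsupp.linearCombination ℂ v l) (f i) = l i * b.repr (v i) (f i) := by
    rw [Finsupp.linearCombination_apply, Finsupp.sum, map_sum, Finsupp.finsetSum_apply,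
      Finset.sum_eq_single_of_mem i hi]
    · simp
    · intro j hj hji
      rw [map_smul, Finsupp.smul_apply, smul_eq_mul]
      by_contra hne'
      exact absurd (hlow j (f i) (fun e ↦ hji (hf e).symm) (right_ne_zero_of_mul hne'))
        (not_lt.2 (hmax j hj))
  rw [hl, map_zero, Finsupp.zero_apply] at h
  exact mul_ne_zero (Finsupp.mem_support_iff.1 hi) (hlead i) h.symm

section Injectivity

variable {r s : ℂˣ} (hrs : Independent r s)

/-- The embedding of `U` into the quantum torus. -/
noncomputable def embedding : U (r : ℂ) s →ₐ[ℂ] Q₄ (r : ℂ) s :=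
  toTorus (torusUnit_isQTorus r s) hrs

/-- The exponents of the leading term of the image of a PBW monomial. -/
def pbwExponent (n : ℕ × ℕ × ℕ × ℕ) : Fin 4 → ℤ :=
  Pi.single 3 (n.2.2.2 : ℤ) + (Pi.single 2 (n.2.2.1 : ℤ) +
    (Pi.single 1 (n.2.1 : ℤ) + Pi.single 0 (n.1 : ℤ)))

lemma pbwExponent_injective : Function.Injective pbwExponent := by
  rintro ⟨a, b, c, d⟩ ⟨a', b', c', d'⟩ h
  have h0 := congrFun h 0
  have h1 := congrFun h 1
  have h2 := congrFun h 2
  have h3 := congrFun h 3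
  simp [pbwExponent] at h0 h1 h2 h3
  simp [*]

lemma embedding_lowMonomial (a b c : ℕ) :
    ∃ z : ℂˣ, embedding hrs (lowMonomial r s a b c) = (z : ℂ) •
      (tmono (torusUnit r s) (Pi.single 2 (c : ℤ) + (Pi.single 1 (b : ℤ) + Pi.single 0 (a : ℤ))) :
        Q₄ (r : ℂ) s) := by
  have h := torusUnit_isQTorus r s
  obtain ⟨z, hz⟩ := ((h.tmono_mul (Pi.single 1 (b : ℤ)) (Pi.single 0 (a : ℤ))).mul_left
    (tmono (torusUnit r s) (Pi.single 2 (c : ℤ)))).trans (h.tmono_mul _ _)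
  refine ⟨z, ?_⟩
  rw [← scalarUnit_mul_val, ← hz]
  simp [lowMonomial, embedding, toTorus_X₁, toTorus_X₂, toTorus_X₃, tmono_single]

/-- The image of `e₂` is a nonzero multiple of `T₄` plus terms of nonpositive `T₄`-degree, so its
`d`-th power has leading term a nonzero multiple of `T₄ ^ d`. -/
lemma torusE₂_pow_sub_mem (hrs : Independent r s) (d : ℕ) :
    ∃ z : ℂˣ, torusE₂ (r : ℂ) s (torusUnit r s) ^ d - (z : ℂ) • (torusUnit r s 3 : Q₄ (r : ℂ) s) ^ d
      ∈ tspan (torusUnit r s) {g | g 3 < d} := by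
  have h := torusUnit_isQTorus r s
  set t := torusUnit r s
  obtain ⟨k, hk⟩ : ∃ k : ℂˣ, (r / ((r ^ 2 - s ^ 2) * (r - s)) : ℂ) = k :=
    ⟨Units.mk0 _ (div_ne_zero r.ne_zero (mul_ne_zero hrs.sq_sub_sq_ne_zero hrs.sub_ne_zero)), rfl⟩
  have hadd : ∀ a ∈ {g : Fin 4 → ℤ | g 3 ≤ 0}, ∀ b ∈ {g : Fin 4 → ℤ | g 3 ≤ 0},
      a + b ∈ {g : Fin 4 → ℤ | g 3 ≤ 0} := by
    intro a ha b hb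
    simp only [Set.mem_ofPred_eq, Pi.add_apply] at *
    omega
  obtain ⟨y, hy, e⟩ : ∃ y ∈ tspan t {g | g 3 ≤ 0},
      torusE₂ (r : ℂ) s t = (k : ℂ) • (t 3 : Q₄ (r : ℂ) s) + y := by
    refine ⟨_, ?_, by rw [torusE₂, hk, add_assoc, smul_add]⟩
    refine Submodule.smul_mem _ _ (add_mem (Submodule.smul_mem _ _ ?_)
      (Submodule.smul_mem _ _ ?_))
    · have h1 := h.mul_mem_tspan (S := {g | g 3 ≤ 0}) (S' := {g | g 3 ≤ 0}) (R := {g | g 3 ≤ 0})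
        hadd
        (tmono_mem_tspan (u := t) (a := Pi.single 1 (-1)) (by simp))
        (tmono_mem_tspan (u := t) (a := Pi.single 2 1) (by simp))
      simpa [tmono_single] using h1
    · have h1 := h.mul_mem_tspan (S := {g | g 3 ≤ 0}) (S' := {g | g 3 ≤ 0}) (R := {g | g 3 ≤ 0})
        hadd
        (tmono_mem_tspan (u := t) (a := Pi.single 1 1) (by simp))
        (tmono_mem_tspan (u := t) (a := Pi.single 0 (-1)) (by simp))
      simpa [tmono_single] using h1
  have ht (n : ℕ) : (t 3 : Q₄ (r : ℂ) s) ^ n ∈ tspan t {g | g 3 ≤ n} := by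
    have := tmono_mem_tspan (u := t) (S := {g | g 3 ≤ n}) (a := Pi.single 3 (n : ℤ)) (by simp)
    simpa [tmono_single] using this
  induction d with
  | zero => exact ⟨1, by simp⟩
  | succ d ih =>
    obtain ⟨z, hz⟩ := ih
    refine ⟨k * z, ?_⟩
    set w := torusE₂ (r : ℂ) s t ^ d - (z : ℂ) • (t 3 : Q₄ (r : ℂ) s) ^ d with hw
    have e1 : torusE₂ (r : ℂ) s t ^ (d + 1) -
        ((k * z : ℂˣ) : ℂ) • (t 3 : Q₄ (r : ℂ) s) ^ (d + 1) =
        torusE₂ (r : ℂ) s t * w + (z : ℂ) • (y * (t 3 : Q₄ (r : ℂ) s) ^ d) := by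
      rw [hw, mul_sub, ← pow_succ', mul_smul_comm]
      -- Only the factor standing before `T₄ ^ d` is expanded; the two powers with exponent `d + 1`
      -- must stay intact to cancel.
      nth_rewrite 3 [e]
      rw [add_mul, pow_succ' (t 3 : Q₄ (r : ℂ) s), smul_mul_assoc, Units.val_mul]
      module
    rw [e1]
    refine add_mem ?_ (Submodule.smul_mem _ _ ?_)
    · have he : torusE₂ (r : ℂ) s t ∈ tspan t {g | g 3 ≤ 1} := by
        rw [e]
        refine add_mem (Submodule.smul_mem _ _ (by simpa using ht 1)) (tspan_mono ?_ hy)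
        intro g hg
        simp only [Set.mem_ofPred_eq] at *
        omega
      refine h.mul_mem_tspan ?_ he hz
      intro a ha b hb
      simp only [Set.mem_ofPred_eq, Pi.add_apply, Nat.cast_add, Nat.cast_one] at *
      omega
    · refine h.mul_mem_tspan ?_ hy (ht d)
      intro a ha b hb
      simp only [Set.mem_ofPred_eq, Pi.add_apply, Nat.cast_add, Nat.cast_one] at *
      omega

lemma embedding_pbwMonomial (n : ℕ × ℕ × ℕ × ℕ) :
    ∃ z : ℂˣ, embedding hrs (pbwMonomial r s n) -
      (z : ℂ) • (tmono (torusUnit r s) (pbwExponent n) : Q₄ (r : ℂ) s)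
      ∈ tspan (torusUnit r s) {g | g 3 < n.2.2.2} := by
  have h := torusUnit_isQTorus r s
  obtain ⟨a, b, c, d⟩ := n
  obtain ⟨z, hz⟩ := embedding_lowMonomial hrs a b c
  obtain ⟨w, hw⟩ := torusE₂_pow_sub_mem hrs d
  obtain ⟨v, hv⟩ := h.tmono_mul (Pi.single 3 (d : ℤ))
    (Pi.single 2 (c : ℤ) + (Pi.single 1 (b : ℤ) + Pi.single 0 (a : ℤ)))
  refine ⟨w * z * v, ?_⟩
  have hlow := tmono_mem_tspan (u := torusUnit r s) (S := {g | g 3 ≤ 0})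
    (a := Pi.single 2 (c : ℤ) + (Pi.single 1 (b : ℤ) + Pi.single 0 (a : ℤ))) (by simp)
  have key := h.mul_mem_tspan (R := {g | g 3 < d}) ?_ hw (Submodule.smul_mem _ (z : ℂ) hlow)
  · convert key using 1
    have hv' := congrArg Units.val hv
    rw [scalarUnit_mul_val, tmono_single, Units.val_mul, zpow_natCast, Units.val_pow_eq_pow_val]
      at hv'
    rw [pbwMonomial, map_mul, hz, map_pow, embedding, toTorus_X₄, sub_mul, smul_mul_assoc,
      mul_smul_comm _ ((torusUnit r s 3 : Q₄ (r : ℂ) s) ^ d), hv', pbwExponent]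
    simp only [Units.val_mul]
    module
  · intro a ha b hb
    simp only [Set.mem_ofPred_eq, Pi.add_apply] at *
    omega

lemma embedding_injective : Function.Injective (embedding hrs) := by
  refine injective_of_span_of_linearIndependent (embedding hrs).toLinearMap (pbwMonomial r s)
    pbwSpan_eq_top (linearIndependent_of_leading (torusBasis hrs) (fun g ↦ g 3) _ pbwExponent
      pbwExponent_injective ?_ ?_)
  all_goals
    intro n
    obtain ⟨z, hz⟩ := embedding_pbwMonomial hrs n
    rw [mem_torus_tspan_iff hrs, ← torusBasis_apply hrs, map_sub, map_smul,
      Module.Basis.repr_self] at hz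
    have hd : pbwExponent n 3 = n.2.2.2 := by simp [pbwExponent]
  · intro h0
    have := hz (pbwExponent n)
    simp only [AlgHom.toLinearMap_apply] at h0
    simp [h0, hd] at this
  · intro g hg h0
    have := hz g
    rw [Finsupp.sub_apply, Finsupp.smul_apply, Finsupp.single_eq_of_ne hg, smul_zero,
      sub_zero] at this
    simpa [hd] using this h0

lemma U_noZeroDivisors (hrs : Independent r s) : NoZeroDivisors (U (r : ℂ) s) :=
  have := torus_noZeroDivisors hrs
  (embedding_injective hrs).noZeroDivisors _ (map_zero _) (map_mul _)

end Injectivity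

/-! ### Polynomial growth and the Ore conditions. -/

lemma exists_poly_lt_two_pow (C : ℕ) : ∃ n : ℕ, (C * n + 1) ^ 4 < 2 ^ n := by
  have h := (tendsto_pow_const_div_const_pow_of_one_lt 4 (one_lt_two (α := ℝ))).eventually_lt_const
    (u := 1 / ((C : ℝ) + 1) ^ 4) (by positivity)
  obtain ⟨n, hn, hn1⟩ := (h.and (Filter.eventually_ge_atTop 1)).exists
  refine ⟨n, ?_⟩
  rw [div_lt_div_iff₀ (by positivity) (by positivity), one_mul, ← mul_pow] at hn
  have h1 : (C * n + 1) ^ 4 ≤ (n * (C + 1)) ^ 4 := Nat.pow_le_pow_left (by nlinarith) 4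
  exact lt_of_le_of_lt h1 (by exact_mod_cast hn)

/-- Two injective endomorphisms that raise a filtration of polynomial growth by one step take a
common nonzero value. -/
lemma exists_common_value_of_growth {V : Type*} [AddCommGroup V] [Module ℂ V]
    (F : ℕ → Submodule ℂ V) [∀ n, FiniteDimensional ℂ (F n)] (h0 : F 0 ≠ ⊥) (C : ℕ)
    (hC : ∀ n, Module.finrank ℂ (F n) ≤ (C * n + 1) ^ 4) (φ ψ : V →ₗ[ℂ] V)
    (hφ : Function.Injective φ) (hψ : Function.Injective ψ)
    (hφF : ∀ n, (F n).map φ ≤ F (n + 1)) (hψF : ∀ n, (F n).map ψ ≤ F (n + 1)) :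
    ∃ x y, x ≠ 0 ∧ φ x = ψ y := by
  by_contra! hne
  have hdisj (n : ℕ) : (F n).map φ ⊓ (F n).map ψ = ⊥ := by
    rw [eq_bot_iff]
    rintro _ ⟨⟨x, -, rfl⟩, ⟨y, -, hy⟩⟩
    rcases eq_or_ne x 0 with rfl | hx
    · simp
    · exact absurd hy.symm (hne x y hx)
  -- Disjoint images of `F n` inside `F (n + 1)` double the dimension at every step, against
  -- polynomial growth.
  have hgrow (n : ℕ) : 2 ^ n ≤ Module.finrank ℂ (F n) := by
    induction n with
    | zero => exact Submodule.one_le_finrank_iff.2 h0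
    | succ n ih =>
      have h1 := Submodule.finrank_sup_add_finrank_inf_eq ((F n).map φ) ((F n).map ψ)
      rw [hdisj, finrank_bot, add_zero, ← (Submodule.equivMapOfInjective φ hφ (F n)).finrank_eq,
        ← (Submodule.equivMapOfInjective ψ hψ (F n)).finrank_eq] at h1
      have h2 := Submodule.finrank_mono (sup_le (hφF n) (hψF n))
      rw [pow_succ]
      omega
  obtain ⟨n, hn⟩ := exists_poly_lt_two_pow C
  exact absurd ((hgrow n).trans (hC n)) (not_le.2 hn)

section Ore

variable {A : Type*} [Ring A] [Algebra ℂ A]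

/-- The Laurent polynomials with exponents in the box `[-n, n]⁴`. -/
def torusBox (u : Fin 4 → Aˣ) (n : ℕ) : Submodule ℂ A :=
  tspan u
    ((Fintype.piFinset fun _ ↦ Finset.Icc (-n : ℤ) n : Finset (Fin 4 → ℤ)) : Set (Fin 4 → ℤ))

variable {r s : ℂˣ} {u : Fin 4 → Aˣ}

lemma IsQTorus.mul_mem_torusBox (h : IsQTorus r s u) {m n : ℕ} {x y : A} (hx : x ∈ torusBox u m)
    (hy : y ∈ torusBox u n) : x * y ∈ torusBox u (m + n) := by
  refine h.mul_mem_tspan ?_ hx hy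
  intro a ha b hb
  simp only [Finset.mem_coe, Fintype.mem_piFinset, Finset.mem_Icc, Pi.add_apply, Nat.cast_add] at *
  exact fun i ↦ ⟨by linarith [(ha i).1, (hb i).1], by linarith [(ha i).2, (hb i).2]⟩

lemma torusBox_mono {m n : ℕ} (h : m ≤ n) : torusBox u m ≤ torusBox u n := by
  refine tspan_mono fun a ha ↦ ?_
  simp only [Finset.mem_coe, Fintype.mem_piFinset, Finset.mem_Icc] at *
  exact fun i ↦ ⟨by linarith [(ha i).1, (Nat.cast_le (α := ℤ)).2 h],
    by linarith [(ha i).2, (Nat.cast_le (α := ℤ)).2 h]⟩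

lemma exists_mem_torusBox (hu : tspan u Set.univ = ⊤) (x : A) : ∃ n, x ∈ torusBox u n := by
  have hx : x ∈ tspan u Set.univ := by rw [hu]; trivial
  induction hx using Submodule.span_induction with
  | mem _ h =>
    obtain ⟨a, -, rfl⟩ := h
    refine ⟨∑ i, (a i).natAbs, tmono_mem_tspan ?_⟩
    simp only [Finset.mem_coe, Fintype.mem_piFinset, Finset.mem_Icc]
    intro i
    have := Finset.single_le_sum (f := fun i ↦ (a i).natAbs) (fun _ _ ↦ Nat.zero_le _)
      (Finset.mem_univ i)
    omega
  | zero => exact ⟨0, zero_mem _⟩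
  | add x y _ _ hx hy =>
    obtain ⟨m, hm⟩ := hx
    obtain ⟨n, hn⟩ := hy
    exact ⟨max m n, add_mem (torusBox_mono (le_max_left _ _) hm)
      (torusBox_mono (le_max_right _ _) hn)⟩
  | smul c x _ hx =>
    obtain ⟨n, hn⟩ := hx
    exact ⟨n, Submodule.smul_mem _ _ hn⟩

instance (n : ℕ) : FiniteDimensional ℂ (torusBox u n) :=
  FiniteDimensional.span_of_finite ℂ ((Finset.finite_toSet _).image _)

lemma finrank_torusBox_le (n : ℕ) : Module.finrank ℂ (torusBox u n) ≤ (2 * n + 1) ^ 4 := by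
  classical
  rw [torusBox, tspan, ← Finset.coe_image]
  refine (finrank_span_finset_le_card _).trans (Finset.card_image_le.trans ?_)
  rw [Fintype.card_piFinset]
  simp only [Int.card_Icc, Finset.prod_const, Finset.card_univ, Fintype.card_fin]
  refine Nat.pow_le_pow_left ?_ 4
  omega

lemma one_mem_torusBox (n : ℕ) : (1 : A) ∈ torusBox u n := by
  refine one_mem_tspan ?_
  simp only [Finset.mem_coe, Fintype.mem_piFinset, Finset.mem_Icc, Pi.zero_apply]
  omega

variable {R : Type*} [Ring R] [Algebra ℂ R] [Nontrivial R]

/-- The filtration consists of preimages of boxes of radius `N * n`, so enlarging a box by `N` is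
one step, and counting lattice points gives the growth constant `2 * N`. -/
lemma exists_common_value (I : R →ₐ[ℂ] A) (hI : Function.Injective I) (φ ψ : R →ₗ[ℂ] R)
    (hφ : Function.Injective φ) (hψ : Function.Injective ψ) (N : ℕ)
    (hφN : ∀ n x, I x ∈ torusBox u n → I (φ x) ∈ torusBox u (n + N))
    (hψN : ∀ n x, I x ∈ torusBox u n → I (ψ x) ∈ torusBox u (n + N)) :
    ∃ x y, x ≠ 0 ∧ φ x = ψ y := by
  let F : ℕ → Submodule ℂ R := fun n ↦ (torusBox u (N * n)).comap I.toLinearMap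
  let g (n : ℕ) : F n →ₗ[ℂ] torusBox u (N * n) := I.toLinearMap.restrict fun _ h ↦ h
  have hg (n : ℕ) : Function.Injective (g n) := fun x y h ↦
    Subtype.ext (hI (congrArg Subtype.val h))
  have (n : ℕ) : FiniteDimensional ℂ (F n) := FiniteDimensional.of_injective (g n) (hg n)
  refine exists_common_value_of_growth F ?_ (2 * N) ?_ φ ψ hφ hψ ?_ ?_
  · refine (Submodule.ne_bot_iff _).2 ⟨1, ?_, one_ne_zero⟩
    rw [Submodule.mem_comap, AlgHom.toLinearMap_apply, map_one]
    exact one_mem_torusBox _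
  · intro n
    refine (LinearMap.finrank_le_finrank_of_injective (hg n)).trans
      ((finrank_torusBox_le _).trans_eq ?_)
    rw [mul_assoc]
  · rintro n _ ⟨x, hx, rfl⟩
    exact hφN _ x hx
  · rintro n _ ⟨x, hx, rfl⟩
    exact hψN _ x hx

lemma exists_torusBox_bound (hu : tspan u Set.univ = ⊤) (a b : A) :
    ∃ N, a ∈ torusBox u N ∧ b ∈ torusBox u N := by
  obtain ⟨m, hm⟩ := exists_mem_torusBox hu a
  obtain ⟨n, hn⟩ := exists_mem_torusBox hu b
  exact ⟨max m n, torusBox_mono (le_max_left _ _) hm, torusBox_mono (le_max_right _ _) hn⟩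

variable [NoZeroDivisors R]

/-- Left multiplications by `a` and `b` serve as the two injective maps. The case `a = 0` is
separate because injectivity fails there. -/
lemma IsQTorus.right_ore (h : IsQTorus r s u) (hu : tspan u Set.univ = ⊤) (I : R →ₐ[ℂ] A)
    (hI : Function.Injective I) (a : R) {b : R} (hb : b ≠ 0) :
    ∃ x y, x ≠ 0 ∧ a * x = b * y := by
  rcases eq_or_ne a 0 with rfl | ha
  · exact ⟨1, 0, one_ne_zero, by simp⟩
  obtain ⟨N, hNa, hNb⟩ := exists_torusBox_bound hu (I a) (I b)
  refine exists_common_value (u := u) I hI (.mulLeft ℂ a) (.mulLeft ℂ b) (mul_right_injective₀ ha)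
    (mul_right_injective₀ hb) N ?_ ?_
  · intro n x hx
    rw [LinearMap.mulLeft_apply, map_mul, add_comm]
    exact h.mul_mem_torusBox hNa hx
  · intro n x hx
    rw [LinearMap.mulLeft_apply, map_mul, add_comm]
    exact h.mul_mem_torusBox hNb hx

lemma IsQTorus.left_ore (h : IsQTorus r s u) (hu : tspan u Set.univ = ⊤) (I : R →ₐ[ℂ] A)
    (hI : Function.Injective I) (a : R) {b : R} (hb : b ≠ 0) :
    ∃ x y, x ≠ 0 ∧ x * a = y * b := by
  rcases eq_or_ne a 0 with rfl | ha
  · exact ⟨1, 0, one_ne_zero, by simp⟩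
  obtain ⟨N, hNa, hNb⟩ := exists_torusBox_bound hu (I a) (I b)
  refine exists_common_value (u := u) I hI (.mulRight ℂ a) (.mulRight ℂ b)
    (mul_left_injective₀ ha) (mul_left_injective₀ hb) N ?_ ?_
  · intro n x hx
    rw [LinearMap.mulRight_apply, map_mul]
    exact h.mul_mem_torusBox hx hNa
  · intro n x hx
    rw [LinearMap.mulRight_apply, map_mul]
    exact h.mul_mem_torusBox hx hNb

/-- In a domain satisfying both Ore conditions, the left Ore localization at the nonzero elements
is also a right ring of fractions. -/
lemma exists_goldieQuotientRing {A : Type} [Ring A] [Algebra ℂ A] [Nontrivial A] [NoZeroDivisors A]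
    (hl : ∀ a b : A, b ≠ 0 → ∃ x y, x ≠ 0 ∧ x * a = y * b)
    (hr : ∀ a b : A, b ≠ 0 → ∃ x y, x ≠ 0 ∧ a * x = b * y) :
    ∃ (K : Type) (_ : Ring K) (_ : Algebra ℂ K) (ι : A →ₐ[ℂ] K), IsGoldieQuotientRing ι := by
  obtain ⟨_⟩ : Nonempty (OreLocalization.OreSet (nonZeroDivisors A)) := by
    rw [OreLocalization.nonempty_oreSet_iff_of_noZeroDivisors]
    intro a b
    obtain ⟨x, y, hx, h⟩ := hl a b (nonZeroDivisors.ne_zero b.2)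
    exact ⟨y, ⟨x, mem_nonZeroDivisors_of_ne_zero hx⟩, h⟩
  let ι : A →ₐ[ℂ] OreLocalization (nonZeroDivisors A) A :=
    { OreLocalization.numeratorRingHom with commutes' := fun _ ↦ rfl }
  have hι (a : A) : ι a = OreLocalization.oreDiv a 1 := rfl
  have hinj : Function.Injective ι := OreLocalization.numeratorHom_inj inf_le_left
  refine ⟨_, inferInstance, inferInstance, ι, ?_, ?_, ?_⟩
  · intro σ hσ
    exact OreLocalization.numerator_isUnit (⟨σ, hσ⟩ : nonZeroDivisors A)
  · intro b
    induction b using OreLocalization.ind with | _ a t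
    -- The right Ore condition turns the left fraction `t⁻¹ a` into a right one: from `a x = t y`
    -- follows `t⁻¹ a x = y`.
    obtain ⟨x, y, hx, h⟩ := hr a t (nonZeroDivisors.ne_zero t.2)
    refine ⟨y, x, mem_nonZeroDivisors_of_ne_zero hx, ?_⟩
    change OreLocalization.oreDiv a t * ι x = ι y
    rw [hι, hι, OreLocalization.mul_div_one, h, OreLocalization.expand' y 1 t, mul_one]
    rfl
  · intro a
    refine ⟨fun h ↦ ⟨1, one_mem _, ?_⟩, ?_⟩
    · rw [mul_one]
      exact hinj (h.trans (map_zero ι).symm)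
    · rintro ⟨σ, hσ, h⟩
      rw [(mul_eq_zero.1 h).resolve_right (nonZeroDivisors.ne_zero hσ), map_zero]

lemma U_exists_goldieQuotientRing (hrs : Independent r s) :
    ∃ (K : Type) (_ : Ring K) (_ : Algebra ℂ K) (ι : U (r : ℂ) s →ₐ[ℂ] K),
      IsGoldieQuotientRing ι := by
  have := U_noZeroDivisors hrs
  have : Nontrivial (U (r : ℂ) s) := (embedding hrs).toRingHom.domain_nontrivial
  exact exists_goldieQuotientRing
    (fun a _ hb ↦ (torusUnit_isQTorus r s).left_ore (torus_tspan_eq_top r s) _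
      (embedding_injective hrs) a hb)
    (fun a _ hb ↦ (torusUnit_isQTorus r s).right_ore (torus_tspan_eq_top r s) _
      (embedding_injective hrs) a hb)

end Ore

/-! ### Recognizing localizations at powers of a unit. -/

lemma inv_pow_mul_pow {K : Type*} [Ring K] (t : Kˣ) (n : ℕ) : ((t⁻¹ : Kˣ) : K) ^ n * (t : K) ^ n = 1 := by
  rw [← Units.val_pow_eq_pow_val, ← Units.val_pow_eq_pow_val, inv_pow, Units.inv_mul]

lemma pow_mul_inv_pow {K : Type*} [Ring K] (t : Kˣ) (n : ℕ) : (t : K) ^ n * ((t⁻¹ : Kˣ) : K) ^ n = 1 := by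
  rw [← Units.val_pow_eq_pow_val, ← Units.val_pow_eq_pow_val, inv_pow, Units.mul_inv]

section Localization

variable {K : Type*} [Ring K] [Algebra ℂ K]

/-- The elements `x` such that for every `n` some `t⁻ⁿ x tᵐ` lies in `A`. -/
def oreSubalgebra (A : Subalgebra ℂ K) (t : Kˣ) (ht : (t : K) ∈ A) : Subalgebra ℂ K where
  carrier := {x | ∀ n : ℕ, ∃ m : ℕ, ((t⁻¹ : Kˣ) : K) ^ n * x * (t : K) ^ m ∈ A}
  algebraMap_mem' c n := ⟨n, by
    rw [← Algebra.commutes, mul_assoc, inv_pow_mul_pow, mul_one]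
    exact A.algebraMap_mem c⟩
  add_mem' {x y} hx hy n := by
    obtain ⟨k, hk⟩ := hx n
    obtain ⟨l, hl⟩ := hy n
    refine ⟨k + l, ?_⟩
    have e : ((t⁻¹ : Kˣ) : K) ^ n * (x + y) * (t : K) ^ (k + l) =
        ((t⁻¹ : Kˣ) : K) ^ n * x * (t : K) ^ k * (t : K) ^ l +
        ((t⁻¹ : Kˣ) : K) ^ n * y * (t : K) ^ l * (t : K) ^ k := by
      rw [mul_assoc _ ((t : K) ^ k), ← pow_add, mul_assoc _ ((t : K) ^ l), ← pow_add,
        add_comm l, mul_add, add_mul]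
    rw [e]
    exact add_mem (mul_mem hk (pow_mem ht _)) (mul_mem hl (pow_mem ht _))
  -- The exponent `k` obtained for `x` is fed to `y`, by inserting `tᵏ t⁻ᵏ`. This is why membership
  -- quantifies over all `n` and not only `n = 0`.
  mul_mem' {x y} hx hy n := by
    obtain ⟨k, hk⟩ := hx n
    obtain ⟨l, hl⟩ := hy k
    refine ⟨l, ?_⟩
    have e : ((t⁻¹ : Kˣ) : K) ^ n * (x * y) * (t : K) ^ l =
        (((t⁻¹ : Kˣ) : K) ^ n * x * (t : K) ^ k) * (((t⁻¹ : Kˣ) : K) ^ k * y * (t : K) ^ l) := by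
      calc _ = ((t⁻¹ : Kˣ) : K) ^ n * x * 1 * (y * (t : K) ^ l) := by
            simp only [mul_assoc, one_mul]
        _ = _ := by rw [← pow_mul_inv_pow t k]; simp only [mul_assoc]
    rw [e]
    exact mul_mem hk hl

variable {A B : Subalgebra ℂ K} {t : Kˣ} (ht : (t : K) ∈ A)

lemma inv_mem_oreSubalgebra : ((t⁻¹ : Kˣ) : K) ∈ oreSubalgebra A t ht := by
  intro n
  refine ⟨n + 1, ?_⟩
  rw [← pow_succ, inv_pow_mul_pow]
  exact one_mem A

lemma mem_oreSubalgebra_of_qcomm {x : K} (hx : x ∈ A) {z : ℂ}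
    (h : x * (t : K) = z • ((t : K) * x)) : x ∈ oreSubalgebra A t ht := by
  intro n
  refine ⟨n, ?_⟩
  rw [mul_assoc, mul_pow_of_qcomm h, mul_smul_comm, ← mul_assoc, inv_pow_mul_pow, one_mul]
  exact Subalgebra.smul_mem _ hx _

/-- Conjugating `x` repeatedly by `t` only adds multiples of `t⁻¹ y`, so one extra factor `t` clears
the denominator. This handles `X₄` against `X₁`. -/
lemma mem_oreSubalgebra_of_qcomm_add {x y : K} (hx : x ∈ A) (hy : y ∈ A) {z w : ℂ}
    (h : x * (t : K) = z • ((t : K) * x) + y) (h' : y * (t : K) = w • ((t : K) * y)) :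
    x ∈ oreSubalgebra A t ht := by
  have key (n : ℕ) : ∃ c : ℂ, ((t⁻¹ : Kˣ) : K) ^ n * x * (t : K) ^ n =
      z ^ n • x + c • (((t⁻¹ : Kˣ) : K) * y) := by
    induction n with
    | zero => exact ⟨0, by simp⟩
    | succ n ih =>
      obtain ⟨c, hc⟩ := ih
      refine ⟨z ^ n + c * w, ?_⟩
      have e : ((t⁻¹ : Kˣ) : K) ^ (n + 1) * x * (t : K) ^ (n + 1) =
          ((t⁻¹ : Kˣ) : K) * (((t⁻¹ : Kˣ) : K) ^ n * x * (t : K) ^ n) * t := by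
        rw [pow_succ', pow_succ]; simp only [mul_assoc]
      rw [e, hc]
      simp only [mul_add, add_mul, mul_smul_comm, smul_mul_assoc, mul_assoc, h, h',
        Units.inv_mul_cancel_left, smul_add]
      rw [pow_succ]
      module
  intro n
  obtain ⟨c, hc⟩ := key n
  refine ⟨n + 1, ?_⟩
  rw [pow_succ, ← mul_assoc, hc, add_mul, smul_mul_assoc, smul_mul_assoc, mul_assoc _ y, h',
    mul_smul_comm, Units.inv_mul_cancel_left]
  exact add_mem (Subalgebra.smul_mem _ (mul_mem hx ht) _)
    (Subalgebra.smul_mem _ (Subalgebra.smul_mem _ hy _) _)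

/-- Taking `n = 0` in the definition of `oreSubalgebra` writes each element of `B` as a right
fraction. Since `oreSubalgebra` is a subalgebra, its hypothesis can be tested on generators of `B`.
-/
lemma isLocalizationAtPowers_of_le (hAB : A ≤ B) (hinv : ((t⁻¹ : Kˣ) : K) ∈ B)
    (hB : B ≤ oreSubalgebra A t ht) : IsLocalizationAtPowers A B (t : K) := by
  refine ⟨hAB, ht, ?_, ?_, ?_⟩
  · rintro _ ⟨n, rfl⟩
    rw [map_pow]
    refine IsUnit.pow _ ⟨⟨⟨t, hAB ht⟩, ⟨_, hinv⟩, ?_, ?_⟩, rfl⟩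
    · exact Subtype.ext (Units.mul_inv t)
    · exact Subtype.ext (Units.inv_mul t)
  · rintro ⟨b, hb⟩
    obtain ⟨m, hm⟩ := hB hb 0
    rw [pow_zero, one_mul] at hm
    exact ⟨⟨_, hm⟩, _, ⟨m, rfl⟩, Subtype.ext rfl⟩
  · intro a
    constructor
    · intro h
      refine ⟨1, one_mem _, ?_⟩
      rw [mul_one]
      exact Subalgebra.inclusion_injective hAB (h.trans (map_zero _).symm)
    · rintro ⟨_, ⟨n, rfl⟩, h⟩
      have h1 : (a : K) * ((t ^ n : Kˣ) : K) = 0 := by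
        rw [Units.val_pow_eq_pow_val]
        exact congrArg Subtype.val h
      have h2 : a = 0 := Subtype.ext ((Units.mul_left_eq_zero _).1 h1)
      rw [h2, map_zero]

end Localization

/-! ### Torus variables in a Goldie quotient ring. -/

section Goldie

variable {A K : Type*} [Ring A] [Ring K] [Algebra ℂ A] [Algebra ℂ K] {ι : A →ₐ[ℂ] K}

lemma IsGoldieQuotientRing.injective (h : IsGoldieQuotientRing ι) : Function.Injective ι := by
  rw [injective_iff_map_eq_zero]
  intro a ha
  obtain ⟨σ, hσ, h0⟩ := (h.ker a).1 ha
  exact (mul_right_mem_nonZeroDivisors_eq_zero_iff hσ).1 h0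

lemma IsGoldieQuotientRing.isUnit_of_ne_zero [NoZeroDivisors A] [Nontrivial A]
    (h : IsGoldieQuotientRing ι) {a : A} (ha : a ≠ 0) : IsUnit (ι a) :=
  h.isUnit a (mem_nonZeroDivisors_of_ne_zero ha)

end Goldie

section Chain

variable {r s : ℂˣ}

lemma X₁_mul_Z' (hrs : Independent r s) : X₁ (r : ℂ) s * Z' (r : ℂ) s =
    ((s ^ 2 * r ^ 2 : ℂˣ) : ℂ) • (Z' (r : ℂ) s * X₁ (r : ℂ) s) := by
  have h := torusUnit_isQTorus r s
  apply embedding_injective hrs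
  have := ((h.comm₁₂.mul h.comm₁₄).mul (QComm.self _)).val
  simpa [embedding, toTorus_X₁, toTorus_Z'] using this

lemma X₂_mul_Z' (hrs : Independent r s) : X₂ (r : ℂ) s * Z' (r : ℂ) s =
    ((1 : ℂˣ) : ℂ) • (Z' (r : ℂ) s * X₂ (r : ℂ) s) := by
  have h := torusUnit_isQTorus r s
  apply embedding_injective hrs
  have := (((QComm.self _).mul h.comm₂₄).mul h.comm₁₂.symm).val
  simpa [embedding, toTorus_X₂, toTorus_Z'] using this

lemma X₃_mul_Z' (hrs : Independent r s) : X₃ (r : ℂ) s * Z' (r : ℂ) s =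
    (((r ^ 2 * s ^ 2)⁻¹ : ℂˣ) : ℂ) • (Z' (r : ℂ) s * X₃ (r : ℂ) s) := by
  have h := torusUnit_isQTorus r s
  apply embedding_injective hrs
  have := ((h.comm₂₃.symm.mul h.comm₃₄).mul h.comm₁₃.symm).val
  simpa [embedding, toTorus_X₃, toTorus_Z'] using this

lemma mul_torusE₂_mul {A : Type*} [Ring A] [Algebra ℂ A] {u : Fin 4 → Aˣ} :
    (u 1 : A) * torusE₂ (r : ℂ) s u * u 0 =
      (r / ((r ^ 2 - s ^ 2) * (r - s)) : ℂ) •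
        ((u 1 : A) * u 3 * u 0 + (s ^ 4 - r ^ 2 * s ^ 2 : ℂ) • ((u 2 : A) * u 0)
          + ((r : ℂ)⁻¹ * s - 1) • ((u 1 : A) * u 1)) := by
  simp only [torusE₂, mul_add, add_mul, mul_smul_comm, smul_mul_assoc, smul_add, mul_assoc,
    Units.mul_inv_cancel_left, Units.inv_mul, mul_one]

/-- This is the torus formula for `X₄` with denominators cleared, hence an identity in `U` that
transfers to every quotient ring. -/
lemma X₂_mul_X₄_mul_X₁ (hrs : Independent r s) :
    X₂ (r : ℂ) s * X₄ (r : ℂ) s * X₁ (r : ℂ) s =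
      (r / ((r ^ 2 - s ^ 2) * (r - s)) : ℂ) •
        (Z' (r : ℂ) s + (s ^ 4 - r ^ 2 * s ^ 2 : ℂ) • (X₃ (r : ℂ) s * X₁ (r : ℂ) s)
          + ((r : ℂ)⁻¹ * s - 1) • (X₂ (r : ℂ) s * X₂ (r : ℂ) s)) := by
  apply embedding_injective hrs
  simp only [embedding, map_mul, map_smul, map_add, toTorus_X₁, toTorus_X₂, toTorus_X₃,
    toTorus_X₄, toTorus_Z', mul_torusE₂_mul]

variable {K : Type*} [Ring K] [Algebra ℂ K] {ι : U (r : ℂ) s →ₐ[ℂ] K}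

lemma exists_isTorusVariables (hrs : Independent r s) (hι : IsGoldieQuotientRing ι) :
    ∃ T : Fin 4 → Kˣ, IsTorusVariables ι T := by
  have := U_noZeroDivisors hrs
  have : Nontrivial (U (r : ℂ) s) := (embedding hrs).toRingHom.domain_nontrivial
  have hne {x : U (r : ℂ) s} {v : (Q₄ (r : ℂ) s)ˣ} (h : embedding hrs x = v) : IsUnit (ι x) := by
    refine hι.isUnit_of_ne_zero fun h0 ↦ v.ne_zero ?_
    rw [← h, h0, map_zero]
  obtain ⟨t₁, h₁⟩ := hne (toTorus_X₁ _ hrs)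
  obtain ⟨t₂, h₂⟩ := hne (toTorus_X₂ _ hrs)
  obtain ⟨t₃, h₃⟩ := hne (toTorus_X₃ _ hrs)
  have hZ := toTorus_Z' (torusUnit_isQTorus r s) hrs
  rw [← Units.val_mul, ← Units.val_mul] at hZ
  obtain ⟨ζ, hζ⟩ := hne hZ
  refine ⟨![t₁, t₂, t₃, t₂⁻¹ * ζ * t₁⁻¹], h₁, h₂, h₃, ?_⟩
  simp [hζ]

variable {T : Fin 4 → Kˣ}

lemma IsTorusVariables.Z'_eq (hT : IsTorusVariables ι T) :
    ι (Z' r s) = (T 1 : K) * T 3 * T 0 := by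
  rw [hT.T₄]
  simp [mul_assoc]

lemma IsTorusVariables.isQTorus (hT : IsTorusVariables ι T) (hrs : Independent r s) :
    IsQTorus r s T := by
  have hm {x y : U (r : ℂ) s} {z : ℂ} (h : x * y = z • (y * x)) :
      ι x * ι y = z • (ι y * ι x) := by
    rw [← map_mul, h, map_smul, map_mul]
  -- `T₄` is expressed through `Z' = T₂ T₄ T₁`, whose commutation relations already hold in `U`.
  have h3 : T 3 = (T 1)⁻¹ * (T 1 * T 3 * T 0) * (T 0)⁻¹ := by simp [mul_assoc]
  have hZ : ι (Z' r s) = ((T 1 * T 3 * T 0 : Kˣ) : K) := by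
    rw [hT.Z'_eq, Units.val_mul, Units.val_mul]
  have h12 : QComm (s ^ 2) (T 0) (T 1) := .of_val (by
    rw [hT.T₁, hT.T₂, hm X₁_mul_X₂, Units.val_pow_eq_pow_val])
  have h13 : QComm (r ^ 2 * s ^ 2) (T 0) (T 2) := .of_val (by
    rw [hT.T₁, hT.T₃, hm X₁_mul_X₃]; simp)
  have h23 : QComm (r * s) (T 1) (T 2) := .of_val (by
    rw [hT.T₂, hT.T₃, hm X₂_mul_X₃]; simp)
  have h1Z : QComm (s ^ 2 * r ^ 2) (T 0) (T 1 * T 3 * T 0) := .of_val (by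
    rw [hT.T₁, ← hZ, hm (X₁_mul_Z' hrs)])
  have h2Z : QComm 1 (T 1) (T 1 * T 3 * T 0) := .of_val (by
    rw [hT.T₂, ← hZ, hm (X₂_mul_Z' hrs)])
  have h3Z : QComm (r ^ 2 * s ^ 2)⁻¹ (T 2) (T 1 * T 3 * T 0) := .of_val (by
    rw [hT.T₃, ← hZ, hm (X₃_mul_Z' hrs)])
  refine ⟨h12, h13, ?_, h23, ?_, ?_⟩
  · rw [h3]
    convert (h12.inv.mul h1Z).mul (QComm.self _).inv using 1
    simp
  · rw [h3]
    convert ((QComm.self _).inv.mul h2Z).mul h12.symm.inv using 1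
    simp
  · rw [h3]
    convert (h23.symm.inv.mul h3Z).mul h13.symm.inv using 1
    rw [inv_inv, inv_inv, inv_mul_cancel_right]

variable (hT : IsTorusVariables ι T) (hrs : Independent r s)

lemma IsTorusVariables.map_X₄ (hT : IsTorusVariables ι T) (hrs : Independent r s) :
    ι (X₄ r s) = torusE₂ (r : ℂ) s T := by
  have h := congrArg ι (X₂_mul_X₄_mul_X₁ hrs)
  simp only [map_mul, map_smul, map_add, ← hT.T₁, ← hT.T₂, ← hT.T₃, hT.Z'_eq] at h
  rw [← mul_torusE₂_mul] at h
  exact (T 1).isUnit.mul_left_cancel ((T 0).isUnit.mul_right_cancel h)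

lemma IsTorusVariables.torusLift_embedding (u : U (r : ℂ) s) :
    torusLift (hT.isQTorus hrs) (embedding hrs u) = ι u := by
  have : (torusLift (hT.isQTorus hrs)).comp (embedding hrs) = ι := by
    refine AlgHom.ext_of_adjoin_eq_top adjoin_X₁_X₄ ?_
    rintro _ (rfl | rfl)
    · simp [embedding, toTorus_X₁, torusUnit, hT.T₁]
    · rw [hT.map_X₄ hrs]
      simp [embedding, toTorus_X₄, torusE₂, torusUnit]
  exact AlgHom.congr_fun this u

end Chain

/-! ### The chain of localizations and the centers. -/

section Chain

variable {r s : ℂˣ} {K : Type*} [Ring K] [Algebra ℂ K] {ι : U (r : ℂ) s →ₐ[ℂ] K} {T : Fin 4 → Kˣ}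

lemma torusLift_range (h : IsQTorus r s T) : (torusLift h).range = B1 T := by
  have hmem (x : K) (hx : x ∈ ({(T 0 : K), (((T 0)⁻¹ : Kˣ) : K), (T 1 : K), (((T 1)⁻¹ : Kˣ) : K),
      (T 2 : K), (((T 2)⁻¹ : Kˣ) : K), (T 3 : K), (((T 3)⁻¹ : Kˣ) : K)} : Set K)) : x ∈ B1 T :=
    Algebra.subset_adjoin hx
  apply le_antisymm
  · rw [← Algebra.map_top, ← torus_adjoin_eq_top, AlgHom.map_adjoin, Algebra.adjoin_le_iff]
    rintro _ ⟨_, ⟨i, rfl⟩ | ⟨i, rfl⟩, rfl⟩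
    · simp only [SetLike.mem_coe, torusLift_torusT]
      fin_cases i <;> exact hmem _ (by simp)
    · simp only [SetLike.mem_coe, torusLift_torusTinv]
      fin_cases i <;> exact hmem _ (by simp)
  · refine Algebra.adjoin_le ?_
    have h1 (i : Fin 4) : (T i : K) ∈ (torusLift h).range := ⟨_, torusLift_torusT h i⟩
    have h2 (i : Fin 4) : (((T i)⁻¹ : Kˣ) : K) ∈ (torusLift h).range :=
      ⟨_, torusLift_torusTinv h i⟩
    rintro _ (rfl | rfl | rfl | rfl | rfl | rfl | rfl | rfl)
    exacts [h1 0, h2 0, h1 1, h2 1, h1 2, h2 2, h1 3, h2 3]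

lemma range_le {B : Subalgebra ℂ K} (h₁ : ι (X₁ r s) ∈ B) (h₄ : ι (X₄ r s) ∈ B) :
    B5 ι ≤ B := by
  rw [B5, ← Algebra.map_top, ← adjoin_X₁_X₄, AlgHom.map_adjoin, Algebra.adjoin_le_iff]
  rintro _ ⟨_, rfl | rfl, rfl⟩
  exacts [h₁, h₄]

lemma B5_le_B4 (hT : IsTorusVariables ι T) : B5 ι ≤ B4 ι T := by
  refine range_le ?_ (Algebra.subset_adjoin (by simp))
  rw [← hT.T₁]
  exact Algebra.subset_adjoin (by simp)

lemma B4_le_B3 (hT : IsTorusVariables ι T) (hrs : Independent r s) : B4 ι T ≤ B3 T := by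
  have hmem (x : K) (hx : x ∈ ({(T 0 : K), (((T 0)⁻¹ : Kˣ) : K), (T 1 : K), (((T 1)⁻¹ : Kˣ) : K),
      (T 2 : K), (T 3 : K)} : Set K)) : x ∈ B3 T := Algebra.subset_adjoin hx
  have h₄ : ι (X₄ r s) ∈ B3 T := by
    rw [hT.map_X₄ hrs, torusE₂]
    exact Subalgebra.smul_mem _ (add_mem (add_mem (hmem _ (by simp))
      (Subalgebra.smul_mem _ (mul_mem (hmem _ (by simp)) (hmem _ (by simp))) _))
      (Subalgebra.smul_mem _ (mul_mem (hmem _ (by simp)) (hmem _ (by simp))) _)) _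
  refine Algebra.adjoin_le ?_
  rintro _ (rfl | rfl | rfl | rfl | rfl)
  · exact hmem _ (by simp)
  · exact hmem _ (by simp)
  · rw [← hT.T₂]; exact hmem _ (by simp)
  · rw [← hT.T₃]; exact hmem _ (by simp)
  · exact h₄

lemma B3_le_B2 : B3 T ≤ B2 T := by
  refine Algebra.adjoin_mono ?_
  rintro _ (rfl | rfl | rfl | rfl | rfl | rfl) <;> simp

lemma B2_le_B1 : B2 T ≤ B1 T := by
  refine Algebra.adjoin_mono ?_
  rintro _ (rfl | rfl | rfl | rfl | rfl | rfl | rfl) <;> simp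

lemma isLocalization_B5_B4 (hT : IsTorusVariables ι T) (hrs : Independent r s) :
    IsLocalizationAtPowers (B5 ι) (B4 ι T) (T 0 : K) := by
  have h := hT.isQTorus hrs
  have hr : (r : ℂ) ≠ 0 := r.ne_zero
  have hm (x : U (r : ℂ) s) : ι x ∈ B5 ι := ⟨x, rfl⟩
  have ht : (T 0 : K) ∈ B5 ι := by rw [hT.T₁]; exact hm _
  refine isLocalizationAtPowers_of_le ht (B5_le_B4 hT) (Algebra.subset_adjoin (by simp))
    (Algebra.adjoin_le ?_)
  have h₂ := h.comm₁₂.symm.val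
  have h₃ := h.comm₁₃.symm.val
  rw [hT.T₂] at h₂
  rw [hT.T₃] at h₃
  rintro _ (rfl | rfl | rfl | rfl | rfl)
  · exact mem_oreSubalgebra_of_qcomm ht ht (QComm.self _).val
  · exact inv_mem_oreSubalgebra ht
  · exact mem_oreSubalgebra_of_qcomm ht (hm _) h₂
  · exact mem_oreSubalgebra_of_qcomm ht (hm _) h₃
  -- The constants come from solving `X₁ X₄ = r² X₄ X₁ + X₂` for `X₄ X₁`.
  · refine mem_oreSubalgebra_of_qcomm_add ht (hm _) (y := (-((r : ℂ) ^ 2)⁻¹) • ι (X₂ r s))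
      (Subalgebra.smul_mem _ (hm _) _) (z := ((r : ℂ) ^ 2)⁻¹) (w := ((s ^ 2)⁻¹ : ℂˣ)) ?_ ?_
    · rw [hT.T₁, ← map_mul, ← map_mul, X₁_mul_X₄, map_add, map_smul]
      match_scalars <;> field_simp <;> ring
    · rw [smul_mul_assoc, h₂, mul_smul_comm, smul_comm]

lemma isLocalization_B4_B3 (hT : IsTorusVariables ι T) (hrs : Independent r s) :
    IsLocalizationAtPowers (B4 ι T) (B3 T) (T 1 : K) := by
  have h := hT.isQTorus hrs
  have hm (x : K) (hx : x ∈ ({(T 0 : K), (((T 0)⁻¹ : Kˣ) : K), ι (X₂ r s), ι (X₃ r s),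
      ι (X₄ r s)} : Set K)) : x ∈ B4 ι T := Algebra.subset_adjoin hx
  have ht : (T 1 : K) ∈ B4 ι T := by rw [hT.T₂]; exact hm _ (by simp)
  refine isLocalizationAtPowers_of_le ht (B4_le_B3 hT hrs) (Algebra.subset_adjoin (by simp))
    (Algebra.adjoin_le ?_)
  have h₀ : (((T 0)⁻¹ : Kˣ) : K) ∈ oreSubalgebra (B4 ι T) (T 1) ht :=
    mem_oreSubalgebra_of_qcomm ht (hm _ (by simp)) h.comm₁₂.symm.inv.symm.val
  rintro _ (rfl | rfl | rfl | rfl | rfl | rfl)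
  · exact mem_oreSubalgebra_of_qcomm ht (hm _ (by simp)) h.comm₁₂.val
  · exact h₀
  · exact mem_oreSubalgebra_of_qcomm ht ht (QComm.self _).val
  · exact inv_mem_oreSubalgebra ht
  · exact mem_oreSubalgebra_of_qcomm ht (by rw [hT.T₃]; exact hm _ (by simp)) h.comm₂₃.symm.val
  · rw [hT.T₄]
    -- The factors of `T₄ = T₂⁻¹ Z' T₁⁻¹` are treated separately; `Z'` lies in `U` and commutes with
    -- `X₂`.
    refine mul_mem (mul_mem (inv_mem_oreSubalgebra ht) ?_) h₀
    refine mem_oreSubalgebra_of_qcomm ht (B5_le_B4 hT ⟨_, rfl⟩) (z := 1) ?_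
    have := congrArg ι (X₂_mul_Z' hrs)
    rw [map_mul, map_smul, map_mul, Units.val_one, one_smul, ← hT.T₂] at this
    rw [one_smul]
    exact this.symm

lemma isLocalization_B3_B2 (h : IsQTorus r s T) :
    IsLocalizationAtPowers (B3 T) (B2 T) (T 2 : K) := by
  have hm (x : K) (hx : x ∈ ({(T 0 : K), (((T 0)⁻¹ : Kˣ) : K), (T 1 : K), (((T 1)⁻¹ : Kˣ) : K),
      (T 2 : K), (T 3 : K)} : Set K)) : x ∈ B3 T := Algebra.subset_adjoin hx
  have ht : (T 2 : K) ∈ B3 T := hm _ (by simp)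
  refine isLocalizationAtPowers_of_le ht B3_le_B2 (Algebra.subset_adjoin (by simp))
    (Algebra.adjoin_le ?_)
  rintro _ (rfl | rfl | rfl | rfl | rfl | rfl | rfl)
  · exact mem_oreSubalgebra_of_qcomm ht (hm _ (by simp)) h.comm₁₃.val
  · exact mem_oreSubalgebra_of_qcomm ht (hm _ (by simp)) h.comm₁₃.symm.inv.symm.val
  · exact mem_oreSubalgebra_of_qcomm ht (hm _ (by simp)) h.comm₂₃.val
  · exact mem_oreSubalgebra_of_qcomm ht (hm _ (by simp)) h.comm₂₃.symm.inv.symm.val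
  · exact mem_oreSubalgebra_of_qcomm ht (hm _ (by simp)) (QComm.self _).val
  · exact inv_mem_oreSubalgebra ht
  · exact mem_oreSubalgebra_of_qcomm ht (hm _ (by simp)) h.comm₃₄.symm.val

lemma isLocalization_B2_B1 (h : IsQTorus r s T) :
    IsLocalizationAtPowers (B2 T) (B1 T) (T 3 : K) := by
  have hm (x : K) (hx : x ∈ ({(T 0 : K), (((T 0)⁻¹ : Kˣ) : K), (T 1 : K), (((T 1)⁻¹ : Kˣ) : K),
      (T 2 : K), (((T 2)⁻¹ : Kˣ) : K), (T 3 : K)} : Set K)) : x ∈ B2 T := Algebra.subset_adjoin hx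
  have ht : (T 3 : K) ∈ B2 T := hm _ (by simp)
  refine isLocalizationAtPowers_of_le ht B2_le_B1 (Algebra.subset_adjoin (by simp))
    (Algebra.adjoin_le ?_)
  rintro _ (rfl | rfl | rfl | rfl | rfl | rfl | rfl | rfl)
  · exact mem_oreSubalgebra_of_qcomm ht (hm _ (by simp)) h.comm₁₄.val
  · exact mem_oreSubalgebra_of_qcomm ht (hm _ (by simp)) h.comm₁₄.symm.inv.symm.val
  · exact mem_oreSubalgebra_of_qcomm ht (hm _ (by simp)) h.comm₂₄.val
  · exact mem_oreSubalgebra_of_qcomm ht (hm _ (by simp)) h.comm₂₄.symm.inv.symm.val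
  · exact mem_oreSubalgebra_of_qcomm ht (hm _ (by simp)) h.comm₃₄.val
  · exact mem_oreSubalgebra_of_qcomm ht (hm _ (by simp)) h.comm₃₄.symm.inv.symm.val
  · exact mem_oreSubalgebra_of_qcomm ht (hm _ (by simp)) (QComm.self _).val
  · exact inv_mem_oreSubalgebra ht

/-- A central element of `B` pulls back to `Q₄`, where commuting with `T₁` and `T₂`, both already in
`U`, makes it scalar. -/
lemma centerIsBaseField_of_le [Nontrivial K] (hT : IsTorusVariables ι T) (hrs : Independent r s)
    {B : Subalgebra ℂ K} (h₅ : B5 ι ≤ B) (h₁ : B ≤ B1 T) : CenterIsBaseField B := by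
  have h := hT.isQTorus hrs
  refine ⟨(algebraMap ℂ (Subalgebra.center ℂ B)).injective, ?_⟩
  rintro ⟨⟨z, hzB⟩, hz⟩
  obtain ⟨q, rfl⟩ : z ∈ (torusLift h).range := by
    rw [torusLift_range]
    exact h₁ hzB
  have hcomm (i : Fin 4) (hi : (T i : K) ∈ B) : Commute (torusT (r : ℂ) s i) q := by
    apply torusLift_injective h hrs
    have := congrArg Subtype.val (Subalgebra.mem_center_iff.1 hz ⟨_, hi⟩)
    rw [map_mul, map_mul, torusLift_torusT]
    exact this
  obtain ⟨c, hc⟩ := torus_eq_algebraMap_of_commute hrs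
    (hcomm 0 (h₅ (by rw [hT.T₁]; exact ⟨_, rfl⟩))) (hcomm 1 (h₅ (by rw [hT.T₂]; exact ⟨_, rfl⟩)))
  refine ⟨c, Subtype.ext (Subtype.ext ?_)⟩
  change algebraMap ℂ K c = torusLift h q
  rw [← hc, AlgHom.commutes]

end Chain

end TwoParamB2

theorem mainTheorem7 (r s : ℂ) (hr : r ≠ 0) (hs : s ≠ 0)
    (hrs : ∀ m n : ℤ, r ^ m * s ^ n = 1 → m = 0 ∧ n = 0) :
    -- `U` has a quotient ring
    (∃ (K : Type) (_ : Ring K) (_ : Algebra ℂ K) (ι : U r s →ₐ[ℂ] K),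
      IsGoldieQuotientRing ι) ∧
    -- the embedding of `U` into the quantum torus
    ∃ I : U r s →ₐ[ℂ] Q₄ r s,
      Function.Injective I ∧
      I (X₁ r s) = torusT r s 0 ∧
      I (X₂ r s) = torusT r s 1 ∧
      I (X₃ r s) = torusT r s 2 ∧
      I (X₄ r s) = (r / ((r ^ 2 - s ^ 2) * (r - s))) •
        (torusT r s 3 + (s ^ 4 - r ^ 2 * s ^ 2) • (torusTinv r s 1 * torusT r s 2)
          + (r⁻¹ * s - 1) • (torusT r s 1 * torusTinv r s 0)) ∧
      -- the chain of localizations, inside any model `K` of the quotient ring of `U`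
      ∀ (K : Type*) [Ring K] [Algebra ℂ K] (ι : U r s →ₐ[ℂ] K), IsGoldieQuotientRing ι →
        ∃ T : Fin 4 → Kˣ, IsTorusVariables ι T ∧
          Function.Injective ι ∧
          -- `B¹ = Q₄`, compatibly with the embeddings of `U`
          (∃ Φ : Q₄ r s ≃ₐ[ℂ] B1 T,
            (∀ i, (Φ (torusT r s i) : K) = T i) ∧ ∀ u, (Φ (I u) : K) = ι u) ∧
          IsLocalizationAtPowers (B5 ι) (B4 ι T) (T 0 : K) ∧
          IsLocalizationAtPowers (B4 ι T) (B3 T) (T 1 : K) ∧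
          IsLocalizationAtPowers (B3 T) (B2 T) (T 2 : K) ∧
          IsLocalizationAtPowers (B2 T) (B1 T) (T 3 : K) ∧
          CenterIsBaseField (B5 ι) ∧
          CenterIsBaseField (B4 ι T) ∧
          CenterIsBaseField (B3 T) ∧
          CenterIsBaseField (B2 T) ∧
          CenterIsBaseField (B1 T) := by
  lift r to ℂˣ using hr.isUnit
  lift s to ℂˣ using hs.isUnit
  have hrs : Independent r s := fun m n e ↦ hrs m n (by
    rw [← Units.val_zpow_eq_zpow_val, ← Units.val_zpow_eq_zpow_val, ← Units.val_mul, e,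
      Units.val_one])
  have hU : Nontrivial (U (r : ℂ) s) := (embedding hrs).toRingHom.domain_nontrivial
  refine ⟨U_exists_goldieQuotientRing hrs, embedding hrs, embedding_injective hrs,
    toTorus_X₁ _ hrs, toTorus_X₂ _ hrs, toTorus_X₃ _ hrs, toTorus_X₄ _ hrs, ?_⟩
  intro K _ _ ι hι
  obtain ⟨T, hT⟩ := exists_isTorusVariables hrs hι
  have h := hT.isQTorus hrs
  have hK : Nontrivial K := hι.injective.nontrivial
  have h54 := B5_le_B4 hT
  have h43 := B4_le_B3 hT hrs
  have h32 := B3_le_B2 (T := T)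
  have h21 := B2_le_B1 (T := T)
  refine ⟨T, hT, hι.injective, ⟨(AlgEquiv.ofInjective _ (torusLift_injective h hrs)).trans
    (Subalgebra.equivOfEq _ _ (torusLift_range h)), fun i ↦ torusLift_torusT h i,
    fun u ↦ hT.torusLift_embedding hrs u⟩, isLocalization_B5_B4 hT hrs,
    isLocalization_B4_B3 hT hrs, isLocalization_B3_B2 h, isLocalization_B2_B1 h, ?_⟩
  have hc {B : Subalgebra ℂ K} := centerIsBaseField_of_le hT hrs (B := B)
  exact ⟨hc le_rfl (h54.trans (h43.trans (h32.trans h21))), hc h54 (h43.trans (h32.trans h21)),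
    hc (h54.trans h43) (h32.trans h21), hc (h54.trans (h43.trans h32)) h21,
    hc (h54.trans (h43.trans (h32.trans h21))) le_rfl⟩
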